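/- For $x\in\mathbb{R}$ let $\|x\|$ denote the distance from $x$ to the nearest integer. For $\alpha>0$ and $M>0$ let $$B^\alpha_{[0,M]}=\{(\|x\|,\|\alpha x\|) : x\in[0,M]\}\subset[0,\tfrac12]^2$$ be the billiard orbit of initial slope $\alpha$ on the square $[0,\frac12]^2$, starting in the corner $(0,0)$ and truncated at the point $(\|M\|,\|\alpha M\|)$. The pieces into which the orbit cuts the square are the closures of the connected components of $(0,\frac12)^2\setminus B^\alpha_{[0,M]}$. Let $\mathcal{A}^\alpha_{[0,M]}$ be the number of different areas of the pieces and $\mathcal{S}^\alpha_{[0,M]}$ the number of different shapes of the pieces, where two pieces have the same shape if an isometry of the plane (reflections allowed) maps one onto the other. **Theorem.** Let $\alpha>0$ and $M>0$ be such that the truncation point lies on the boundary of the square, i.e. $(\|M\|,\|\alpha M\|)\in[0,\frac12]^2\setminus(0,\frac12)^2$. Then the pieces form a partition of $[0,\frac12]^2$ into polygons: there are finitely many of them, each is a convex polygon with non-empty interior, they cover the square, and distinct ones have disjoint interiors. Moreover $$\mathcal{A}^\alpha_{[0,M]}\le 13\qquad\text{and}\qquad \mathcal{S}^\alpha_{[0,M]}\le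 16 .$$ These bounds are best possible: for $\alpha=\sqrt{10}/7$ and $N=11$ both are attained, $\mathcal{A}^\alpha_{[0,M]}=13$ and $\mathcal{S}^\alpha_{[0,M]}=16$, where $M$ is the parameter at which the half-line $\{(x,\alpha x):x\ge 0\}$ leaves the $N$-th of the unit squares $[k,k+1)\times[m,m+1)$, $k,m\in\mathbb{Z}$, that it traverses (so that $0\le x<M$ is exactly the part of the half-line in the first $N$ of these squares); the truncation point for this $M$ lies on the boundary of $[0,\frac12]^2$. -/

import Mathlib

open MeasureTheory

namespace Billiard

/-- The Euclidean plane. -/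
abbrev Plane : Type := EuclideanSpace ℝ (Fin 2)

/-- The distance `‖x‖` from `x` to the nearest integer. -/
noncomputable def distNearestInt (x : ℝ) : ℝ := |x - round x|

/-- The billiard table `[0, 1/2]²`. -/
def table : Set Plane := {p | ∀ i, p i ∈ Set.Icc (0 : ℝ) (1 / 2)}

/-- The open square `(0, 1/2)²`. -/
def openTable : Set Plane := {p | ∀ i, p i ∈ Set.Ioo (0 : ℝ) (1 / 2)}

/-- The point `(‖x‖, ‖αx‖)` of the billiard trajectory with initial slope `α`. -/
noncomputable def orbitPoint (α x : ℝ) : Plane :=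
  !₂[distNearestInt x, distNearestInt (α * x)]

/-- The truncated billiard orbit `{(‖x‖, ‖αx‖) : x ∈ [0, M]}`. -/
def orbit (α M : ℝ) : Set Plane := orbitPoint α '' Set.Icc 0 M

/-- The pieces into which the truncated orbit cuts the table: the closures of the connected
components of the open square with the orbit removed. -/
def pieces (α M : ℝ) : Set (Set Plane) :=
  {P | ∃ p ∈ openTable \ orbit α M,
    P = closure (connectedComponentIn (openTable \ orbit α M) p)}

/-- A (filled, nondegenerate, convex) polygon: the convex hull of finitely many points, with
nonempty interior. -/
def IsConvexPolygon (P : Set Plane) : Prop :=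
  (∃ V : Set Plane, V.Finite ∧ P = convexHull ℝ V) ∧ (interior P).Nonempty

/-- `F` is a partition of `S` into finitely many polygons: they cover `S`, and distinct ones
have no common interior point. -/
def IsPolygonPartition (F : Set (Set Plane)) (S : Set Plane) : Prop :=
  F.Finite ∧ (∀ P ∈ F, IsConvexPolygon P) ∧ ⋃₀ F = S ∧
    F.Pairwise fun P Q => Disjoint (interior P) (interior Q)

/-- Two sets have the same shape if an isometry of the plane (a composition of translations,
rotations and reflections) carries one onto the other. -/
def SameShape (P Q : Set Plane) : Prop := ∃ e : Plane ≃ᵢ Plane, e '' P = Q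

/-- Having the same shape is an equivalence relation. -/
def shapeSetoid : Setoid (Set Plane) where
  r := SameShape
  iseqv :=
    { refl := fun P => ⟨IsometryEquiv.refl Plane, Set.image_id P⟩
      symm := by
        rintro P Q ⟨e, rfl⟩
        exact ⟨e.symm, e.toEquiv.symm_image_image P⟩
      trans := by
        rintro P Q R ⟨e, rfl⟩ ⟨f, rfl⟩
        exact ⟨e.trans f, by ext p; simp⟩ }

/-- The number of different areas of the pieces. -/
noncomputable def numAreas (α M : ℝ) : ℕ∞ :=
  Set.encard ((fun P : Set Plane => volume P) '' pieces α M)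

/-- The number of different shapes of the pieces, up to isometry. -/
noncomputable def numShapes (α M : ℝ) : ℕ∞ :=
  Set.encard (Quotient.mk shapeSetoid '' pieces α M)

/-- The index `(k, m)` of the unit square `[k, k + 1) × [m, m + 1)` containing `(x, αx)`. -/
noncomputable def unitSquareAt (α x : ℝ) : ℤ × ℤ := (⌊x⌋, ⌊α * x⌋)

/-- `M` is the parameter at which the half-line `x ↦ (x, αx)`, `x ≥ 0`, has just completed the
`N`-th unit square that it traverses: exactly `N` unit squares are met for `0 ≤ x < M`, and at
`x = M` a new one is entered. -/
def CompletesSquares (α : ℝ) (N : ℕ) (M : ℝ) : Prop :=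
  (unitSquareAt α '' Set.Ico 0 M).encard = (N : ℕ∞) ∧
    unitSquareAt α M ∉ unitSquareAt α '' Set.Ico 0 M

end Billiard

namespace Billiard

/-! Unfold the billiard. In the coordinates `u = y - αx` and `v = y + αx` the orbit consists of
segments `u = const` and `v = const`. Inside the open table it is exactly the trace of two families
of full lines: the positions `u` are the points `jα` modulo `1 + α` for `2k + 2` consecutive indices
`j`, and the positions `v` are such points for `2k' + 1` consecutive indices (`mem_orbit_iff`). This
uses that the truncation point is on the boundary, since the orbit then ends with a complete
segment.

The numbers of indices differ by one, so one form of the three gap theorem covers both families: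
every gap, of either family, has length `r`, `l` or `r + l` with the same `r` and `l` (`three_gap`,
`three_gap_lines`).

A piece is a box (a gap in `u` times a gap in `v`) intersected with the table. If no wall cuts it,
it is a parallelogram with one of 6 unordered pairs of gap lengths. Along a wall the two families
are reflected into each other, so a piece that meets one wall is normally half a rhombus: 3 areas,
but 6 shapes, as vertical and horizontal walls give different halves. This fails only at a corner
other than the origin, which both families' lines through `0` take care of, and at the one wall
point where the orbit stops. Uniqueness of that point holds because the unmatched positions on all
four walls lie in one residue class modulo `1 + α`, while the walls together make up one period
(`exception_mem`, `exception_wall_eq`). Hence 6 + 3 + 4 = 13 areas and 6 + 6 + 4 = 16 shapes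
(`cell_cases` and the two counting lemmas).

For sharpness, 13 pieces of the example have areas that are distinct because `α² = 10/49` turns each
comparison into one linear in `α`. Three more triangles on the bottom wall repeat areas of triangles
on the left wall, but differ from them in the ratio of squared diameter to area (`IsLong`). -/

/-! ### Rotation points modulo `1 + α` and the three gap theorem -/

/-- The points `jα` with `lo ≤ j ≤ hi` of the rotation by `α` on a circle of length `1 + α`,
lifted to the real line. -/
def rotPts (α : ℝ) (lo hi : ℤ) : Set ℝ :=
  {c | ∃ j q : ℤ, lo ≤ j ∧ j ≤ hi ∧ c = j * α - q * (1 + α)}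

/-- `a < b` are consecutive elements of `A`. -/
def Consec (A : Set ℝ) (a b : ℝ) : Prop :=
  a ∈ A ∧ b ∈ A ∧ a < b ∧ ∀ x ∈ A, a < x → b ≤ x

theorem rotPts_add {α x y : ℝ} {lo hi lo' hi' : ℤ} (hx : x ∈ rotPts α lo hi)
    (hy : y ∈ rotPts α lo' hi') : x + y ∈ rotPts α (lo + lo') (hi + hi') := by
  obtain ⟨j, q, h1, h2, rfl⟩ := hx
  obtain ⟨j', q', h1', h2', rfl⟩ := hy
  exact ⟨j + j', q + q', by omega, by omega, by push_cast; ring⟩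

theorem rotPts_neg {α x : ℝ} {lo hi : ℤ} (hx : x ∈ rotPts α lo hi) :
    -x ∈ rotPts α (-hi) (-lo) := by
  obtain ⟨j, q, h1, h2, rfl⟩ := hx
  exact ⟨-j, -q, by omega, by omega, by push_cast; ring⟩

theorem rotPts_mono {α : ℝ} {lo hi lo' hi' : ℤ} (h1 : lo' ≤ lo) (h2 : hi ≤ hi') :
    rotPts α lo hi ⊆ rotPts α lo' hi' := by
  rintro x ⟨j, q, a, b, rfl⟩
  exact ⟨j, q, by omega, by omega, rfl⟩

theorem rotPts_finite {α : ℝ} (hα : 0 < α) (lo hi : ℤ) (a b : ℝ) :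
    (rotPts α lo hi ∩ Set.Icc a b).Finite := by
  have hfin : (⋃ j ∈ Set.Icc lo hi, (fun q : ℤ => (j * α - q * (1 + α) : ℝ)) ''
      Set.Icc ⌈(j * α - b) / (1 + α)⌉ ⌊(j * α - a) / (1 + α)⌋).Finite :=
    (Set.finite_Icc lo hi).biUnion fun j _ => (Set.finite_Icc _ _).image _
  refine hfin.subset ?_
  rintro x ⟨⟨j, q, h1, h2, rfl⟩, ha, hb⟩
  simp only [Set.mem_iUnion]
  refine ⟨j, ⟨h1, h2⟩, q, ⟨?_, ?_⟩, rfl⟩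
  · rw [Int.ceil_le, div_le_iff₀ (by linarith)]; linarith
  · rw [Int.le_floor, le_div_iff₀ (by linarith)]; linarith

theorem exists_min_pos_rotPts {α : ℝ} (hα : 0 < α) {lo hi : ℤ} (h1 : lo ≤ 0) (h2 : 0 ≤ hi) :
    ∃ r ∈ rotPts α lo hi, 0 < r ∧ r ≤ 1 + α ∧ ∀ x ∈ rotPts α lo hi, 0 < x → r ≤ x := by
  have hL : (1 + α) ∈ rotPts α lo hi := ⟨0, -1, h1, h2, by push_cast; ring⟩
  have hfin : (rotPts α lo hi ∩ Set.Ioc 0 (1 + α)).Finite :=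
    (rotPts_finite hα lo hi 0 (1 + α)).subset
      (Set.inter_subset_inter_right _ Set.Ioc_subset_Icc_self)
  obtain ⟨r, ⟨hr, hr0, hr1⟩, hmin⟩ :=
    Set.exists_min_image _ id hfin ⟨1 + α, hL, by constructor <;> linarith⟩
  refine ⟨r, hr, hr0, hr1, fun x hx hx0 => ?_⟩
  by_cases hxL : x ≤ 1 + α
  · exact hmin x ⟨hx, hx0, hxL⟩
  · linarith

/-- The three gap theorem, for all sets of `n` or of `n + 1` consecutive points of the rotation
at once. -/
theorem three_gap {α : ℝ} (hα : 0 < α) {n : ℤ} (hn : 0 ≤ n) : ∃ r l : ℝ, 0 < r ∧ 0 < l ∧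
    ∀ a b : ℝ, Consec (rotPts α 0 n) a b ∨ Consec (rotPts α 0 (n - 1)) a b →
      b - a = r ∨ b - a = l ∨ b - a = r + l := by
  -- `r` and `l` are the shortest positive displacements that raise, respectively lower, the index
  -- by at most `n`; `p ≥ 0` and `q ≤ 0` are the index changes that realise them.
  obtain ⟨r, ⟨p, qr, hp0, hpn, hr⟩, hr0, hr1, hrmin⟩ :=
    exists_min_pos_rotPts hα (le_refl 0) hn
  obtain ⟨l, ⟨q, ql, hq0, hqn, hl⟩, hl0, hl1, hlmin⟩ :=
    exists_min_pos_rotPts hα (lo := -n) (by omega) (le_refl 0)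
  have hL : 0 < 1 + α := by linarith
  have key : ∀ a b : ℝ, Consec (rotPts α 0 n) a b → b - a = r ∨ b - a = l ∨ b - a = r + l := by
    rintro a b ⟨⟨j, ja, hj0, hjn, ha⟩, ⟨k, kb, hk0, hkn, hb⟩, hab, hgap⟩
    have hr' : j + p ≤ n → b ≤ a + r := fun h =>
      hgap _ ⟨j + p, ja + qr, by omega, h, by push_cast; rw [ha, hr]; ring⟩ (by linarith)
    have hl' : 0 ≤ j + q → b ≤ a + l := fun h =>
      hgap _ ⟨j + q, ja + ql, h, by omega, by push_cast; rw [ha, hl]; ring⟩ (by linarith)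
    have hrl : 0 ≤ j + p + q → j + p + q ≤ n → b ≤ a + r + l := fun h h' =>
      hgap _ ⟨j + p + q, ja + qr + ql, h, h', by push_cast; rw [ha, hr, hl]; ring⟩ (by linarith)
    rcases le_total j k with hjk | hjk
    -- If the gap is longer than `r`, raising by `p` must leave the window, and the remainder `b - a
    -- - r` lowers the index, so it is at least `l`. Then lowering by `q` leaves the window too, and
    -- this puts `j + p + q` back inside it, so `a + r + l` is a point of the set.
    · have h1 : r ≤ b - a := hrmin _ ⟨k - j, kb - ja, by omega, by omega, by
        push_cast; rw [ha, hb]; ring⟩ (by linarith)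
      rcases eq_or_lt_of_le h1 with h1 | h1
      · exact Or.inl h1.symm
      have h2 : n < j + p := by by_contra h; linarith [hr' (by omega)]
      have h3 : l ≤ b - a - r := hlmin _ ⟨k - j - p, kb - ja - qr, by omega, by omega, by
        push_cast; rw [ha, hb, hr]; ring⟩ (by linarith)
      have h4 : j + q < 0 := by by_contra h; linarith [hl' (by omega)]
      exact Or.inr (Or.inr (by linarith [hrl (by omega) (by omega)]))
    · have h1 : l ≤ b - a := hlmin _ ⟨k - j, kb - ja, by omega, by omega, by
        push_cast; rw [ha, hb]; ring⟩ (by linarith)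
      rcases eq_or_lt_of_le h1 with h1 | h1
      · exact Or.inr (Or.inl h1.symm)
      have h2 : j + q < 0 := by by_contra h; linarith [hl' (by omega)]
      have h3 : r ≤ b - a - l := hrmin _ ⟨k - j - q, kb - ja - ql, by omega, by omega, by
        push_cast; rw [ha, hb, hl]; ring⟩ (by linarith)
      have h4 : n < j + p := by by_contra h; linarith [hr' (by omega)]
      exact Or.inr (Or.inr (by linarith [hrl (by omega) (by omega)]))
  refine ⟨r, l, hr0, hl0, fun a b h => ?_⟩
  rcases h with h | h
  · exact key a b h
  -- The smaller window lacks only the index `n`. A gap containing such a missing point `z` splits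
  -- there into a part of length `r` and a part of length `l`; any other gap is already a gap of the
  -- larger window.
  by_cases hz : ∃ z, (∃ t : ℤ, z = n * α - t * (1 + α)) ∧ a < z ∧ z < b
  · obtain ⟨z, ⟨t, hzt⟩, haz, hzb⟩ := hz
    obtain ⟨⟨j, ja, hj0, hjn, ha⟩, ⟨k, kb, hk0, hkn, hb⟩, hab, hgap⟩ := h
    have hbL : b ≤ a + (1 + α) :=
      hgap _ ⟨j, ja - 1, hj0, hjn, by push_cast; rw [ha]; ring⟩ (by linarith)
    have h1 : l ≤ b - z := hlmin _ ⟨k - n, kb - t, by omega, by omega, by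
      push_cast; rw [hzt, hb]; ring⟩ (by linarith)
    have h2 : r ≤ z - a := hrmin _ ⟨n - j, t - ja, by omega, by omega, by
      push_cast; rw [hzt, ha]; ring⟩ (by linarith)
    -- Excludes `p = 0` and `q = 0`: the corresponding displacement would be at least a whole
    -- period, but `r + l ≤ b - a ≤ 1 + α`. So `n + q` and `n - p` are indices of the smaller
    -- window.
    have multL : ∀ (x : ℝ) (s : ℤ), 0 < x → x = ((0 : ℤ) : ℝ) * α - s * (1 + α) → 1 + α ≤ x := by
      intro x s hx hxs
      push_cast at hxs
      have : (s : ℝ) < 0 := by by_contra h; push Not at h; nlinarith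
      have : (s : ℝ) ≤ -1 := by
        have : s < 0 := by exact_mod_cast this
        exact_mod_cast (by omega : s ≤ -1)
      nlinarith
    have hq : q < 0 := by
      rcases eq_or_lt_of_le hqn with rfl | h
      · linarith [multL l ql hl0 hl]
      · exact h
    have hp : 0 < p := by
      rcases eq_or_lt_of_le hp0 with rfl | h
      · linarith [multL r qr hr0 hr]
      · exact h
    have h3 : b ≤ z + l := hgap _ ⟨n + q, t + ql, by omega, by omega, by
      push_cast; rw [hzt, hl]; ring⟩ (by linarith)
    have h4 : ¬ (a < z - r) := fun h => by
      have := hgap _ ⟨n - p, t - qr, by omega, by omega, by push_cast; rw [hzt, hr]; ring⟩ h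
      linarith
    exact Or.inr (Or.inr (by linarith))
  · refine key a b ⟨rotPts_mono le_rfl (by omega) h.1, rotPts_mono le_rfl (by omega) h.2.1,
      h.2.2.1, ?_⟩
    rintro x ⟨j, t, hj0, hjn, hx⟩ hax
    by_cases hj : j = n
    · by_contra hxb
      exact hz ⟨x, ⟨t, by rw [hx, hj]⟩, hax, by linarith⟩
    · exact h.2.2.2 x ⟨j, t, hj0, by omega, hx⟩ hax

theorem Consec.shift {α a b : ℝ} {lo hi : ℤ} (k : ℤ) (h : Consec (rotPts α lo hi) a b) :
    Consec (rotPts α (lo + k) (hi + k)) (a + k * α) (b + k * α) := by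
  have hk : (k * α : ℝ) ∈ rotPts α k k := ⟨k, 0, le_rfl, le_rfl, by push_cast; ring⟩
  refine ⟨rotPts_add h.1 hk, rotPts_add h.2.1 hk, by linarith [h.2.2.1], fun x hx hax => ?_⟩
  have := h.2.2.2 (x + -(k * α)) (by simpa using rotPts_add hx (rotPts_neg hk)) (by linarith)
  linarith

/-- The admissible pairs of index bounds: `k = ⌊m / 2⌋` and `k' = ⌊(m + 1) / 2⌋` for some `m`. -/
structure Bounds (k k' : ℤ) : Prop where
  nonneg : 0 ≤ k
  alt : k' = k ∨ k' = k + 1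

/-- The positions of the lines of slope `α` met by the orbit. -/
abbrev linesU (α : ℝ) (k : ℤ) : Set ℝ := rotPts α (-k - 1) k

/-- The positions of the lines of slope `-α` met by the orbit. -/
abbrev linesV (α : ℝ) (k' : ℤ) : Set ℝ := rotPts α (-k') k'

/-- After a shift of the indices both windows start at `0`, and their sizes `2k + 2` and `2k' + 1`
are consecutive integers in either order. This is why one pair `r`, `l` serves both families. -/
theorem three_gap_lines {α : ℝ} (hα : 0 < α) {k k' : ℤ} (hk : Bounds k k') :
    ∃ r l : ℝ, 0 < r ∧ 0 < l ∧
    ∀ a b : ℝ, Consec (linesU α k) a b ∨ Consec (linesV α k') a b →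
      b - a = r ∨ b - a = l ∨ b - a = r + l := by
  have hk0 := hk.nonneg
  rcases hk.alt with rfl | rfl
  · obtain ⟨r, l, hr, hl, h⟩ := three_gap hα (n := 2 * k' + 1) (by omega)
    refine ⟨r, l, hr, hl, fun a b hab => ?_⟩
    rcases hab with hab | hab
    · have := hab.shift (k' + 1)
      have := h _ _ (Or.inl (by convert this using 2 <;> ring))
      simpa using this
    · have := hab.shift k'
      have := h _ _ (Or.inr (by convert this using 2 <;> ring))
      simpa using this
  · obtain ⟨r, l, hr, hl, h⟩ := three_gap hα (n := 2 * k + 2) (by omega)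
    refine ⟨r, l, hr, hl, fun a b hab => ?_⟩
    rcases hab with hab | hab
    · have := hab.shift (k + 1)
      have := h _ _ (Or.inr (by convert this using 2 <;> ring))
      simpa using this
    · have := hab.shift (k + 1)
      have := h _ _ (Or.inl (by convert this using 2 <;> ring))
      simpa using this

/-- A gap is at most `α` and at most `1` unless its end points are the two extreme points of the
rotation. -/
theorem Consec.le_of_ne {α a b : ℝ} {lo hi : ℤ} (hα : 0 < α) (h : Consec (rotPts α lo hi) a b)
    (hne : ∀ q : ℤ, a + b ≠ (lo + hi) * α - q * (1 + α)) : b - a ≤ α ∧ b - a ≤ 1 := by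
  obtain ⟨⟨j, s, hj0, hjn, ha⟩, ⟨i, t, hi0, hin, hb⟩, hab, hgap⟩ := h
  constructor
  · by_cases h1 : j < hi
    · have := hgap (a + α) ⟨j + 1, s, by omega, by omega, by push_cast; rw [ha]; ring⟩ (by linarith)
      linarith
    by_cases h2 : lo < i
    · by_contra h3
      have := hgap (b - α) ⟨i - 1, t, by omega, by omega, by push_cast; rw [hb]; ring⟩ (by linarith)
      linarith
    obtain rfl : j = hi := by omega
    obtain rfl : i = lo := by omega
    exact absurd (by push_cast; rw [ha, hb]; ring) (hne (s + t))
  · by_cases h1 : lo < j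
    · have := hgap (a + 1) ⟨j - 1, s - 1, by omega, by omega, by push_cast; rw [ha]; ring⟩
        (by linarith)
      linarith
    by_cases h2 : i < hi
    · by_contra h3
      have := hgap (b - 1) ⟨i + 1, t + 1, by omega, by omega, by push_cast; rw [hb]; ring⟩
        (by linarith)
      linarith
    obtain rfl : j = lo := by omega
    obtain rfl : i = hi := by omega
    exact absurd (by push_cast; rw [ha, hb]; ring) (hne (s + t))

theorem int_mul_ne {x L : ℝ} (h0 : 0 < x) (h1 : x < L) (q : ℤ) : x ≠ q * L := by
  intro h
  have hL : 0 < L := h0.trans h1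
  have h2 : (0 : ℝ) < q := by by_contra h; push Not at h; nlinarith
  have h3 : (1 : ℝ) ≤ q := by exact_mod_cast (by exact_mod_cast h2 : (0 : ℤ) < q)
  nlinarith

/-- The excluded case would make `a + b + α` a multiple of `1 + α`, but within the range of `coordU`
on the table this number lies strictly between `0` and `1 + α`. The bounds keep a triangle standing
on one wall from crossing the opposite wall. -/
theorem Consec.le_of_linesU {α a b : ℝ} {k : ℤ} (hα : 0 < α) (h : Consec (linesU α k) a b)
    (ha : -(α / 2) ≤ a) (hb : b ≤ 1 / 2) : b - a ≤ α ∧ b - a ≤ 1 := by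
  refine h.le_of_ne hα fun q hq => ?_
  have hab := h.2.2.1
  push_cast at hq
  refine int_mul_ne (x := a + b + α) (L := 1 + α) (by linarith) (by linarith) (-q) ?_
  push_cast
  linarith

theorem Consec.le_of_linesV {α a b : ℝ} {k : ℤ} (hα : 0 < α) (h : Consec (linesV α k) a b)
    (ha : 0 ≤ a) (hb : b ≤ (1 + α) / 2) : b - a ≤ α ∧ b - a ≤ 1 := by
  refine h.le_of_ne hα fun q hq => ?_
  have hab := h.2.2.1
  push_cast at hq
  refine int_mul_ne (x := a + b) (L := 1 + α) (by linarith) (by linarith) (-q) ?_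
  push_cast
  linarith

/-! ### Unfolding the orbit into two families of lines -/

/-- The coordinate that is constant on lines of slope `α`. -/
def coordU (α : ℝ) (p : Plane) : ℝ := p 1 - α * p 0

/-- The coordinate that is constant on lines of slope `-α`. -/
def coordV (α : ℝ) (p : Plane) : ℝ := p 1 + α * p 0

theorem mem_openTable_iff {p : Plane} :
    p ∈ openTable ↔ 0 < p 0 ∧ p 0 < 1 / 2 ∧ 0 < p 1 ∧ p 1 < 1 / 2 := by
  simp [openTable, Fin.forall_fin_two, and_assoc]

theorem mem_table_iff {p : Plane} :
    p ∈ table ↔ 0 ≤ p 0 ∧ p 0 ≤ 1 / 2 ∧ 0 ≤ p 1 ∧ p 1 ≤ 1 / 2 := by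
  simp [table, Fin.forall_fin_two, and_assoc]

theorem distNearestInt_eq_iff {t x : ℝ} (h0 : 0 < x) (h1 : x < 1 / 2) :
    distNearestInt t = x ↔ ∃ n : ℤ, t = n + x ∨ t = n - x := by
  unfold distNearestInt
  constructor
  · intro h
    refine ⟨round t, ?_⟩
    rcases abs_cases (t - round t) with h2 | h2
    · left; linarith
    · right; linarith
  · rintro ⟨n, rfl | rfl⟩
    · have : round ((n : ℝ) + x) = n := by
        rw [round_eq, Int.floor_eq_iff]; constructor <;> linarith
      rw [this, add_sub_cancel_left, abs_of_pos h0]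
    · have : round ((n : ℝ) - x) = n := by
        rw [round_eq, Int.floor_eq_iff]; constructor <;> linarith
      rw [this, sub_sub_cancel_left, abs_neg, abs_of_pos h0]

theorem orbitPoint_eq_iff {α t : ℝ} {p : Plane} :
    orbitPoint α t = p ↔ distNearestInt t = p 0 ∧ distNearestInt (α * t) = p 1 := by
  rw [orbitPoint]
  constructor
  · rintro rfl; simp
  · rintro ⟨h1, h2⟩
    ext i
    fin_cases i
    · simpa using h1
    · simpa using h2

/-- Reversing time leaves the orbit point unchanged, so of the four sign choices two can be absorbed
by allowing negative times; this is what the absolute values record. -/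
theorem mem_orbit_iff_exists_int {α M : ℝ} {p : Plane} (hp : p ∈ openTable) :
    p ∈ orbit α M ↔
      (∃ P Q : ℤ, |P + p 0| ≤ M ∧ α * (P + p 0) = Q + p 1) ∨
      (∃ P Q : ℤ, |P - p 0| ≤ M ∧ α * (P - p 0) = Q + p 1) := by
  obtain ⟨h1, h2, h3, h4⟩ := mem_openTable_iff.1 hp
  have key : p ∈ orbit α M ↔ ∃ t, 0 ≤ t ∧ t ≤ M ∧ (∃ n : ℤ, t = n + p 0 ∨ t = n - p 0) ∧
      (∃ n : ℤ, α * t = n + p 1 ∨ α * t = n - p 1) := by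
    simp only [orbit, Set.mem_image, orbitPoint_eq_iff, distNearestInt_eq_iff h1 h2,
      distNearestInt_eq_iff h3 h4, Set.mem_Icc, and_assoc]
  rw [key]
  constructor
  · rintro ⟨t, ht0, htM, ⟨P, hP | hP⟩, ⟨Q, hQ | hQ⟩⟩
    · left
      exact ⟨P, Q, by rw [← hP, abs_of_nonneg ht0]; exact htM, by rw [← hP, hQ]⟩
    · right
      refine ⟨-P, -Q, ?_, ?_⟩
      · push_cast
        rw [show (-P - p 0 : ℝ) = -t by rw [hP]; ring, abs_neg, abs_of_nonneg ht0]; exact htM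
      · push_cast
        rw [show (-P - p 0 : ℝ) = -t by rw [hP]; ring]; linarith
    · right
      exact ⟨P, Q, by rw [← hP, abs_of_nonneg ht0]; exact htM, by rw [← hP, hQ]⟩
    · left
      refine ⟨-P, -Q, ?_, ?_⟩
      · push_cast
        rw [show (-P + p 0 : ℝ) = -t by rw [hP]; ring, abs_neg, abs_of_nonneg ht0]; exact htM
      · push_cast
        rw [show (-P + p 0 : ℝ) = -t by rw [hP]; ring]; linarith
  · rintro (⟨P, Q, hM, hQ⟩ | ⟨P, Q, hM, hQ⟩)
    · refine ⟨|P + p 0|, abs_nonneg _, hM, ?_⟩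
      rcases abs_cases (P + p 0 : ℝ) with ⟨h, _⟩ | ⟨h, _⟩ <;> rw [h]
      · exact ⟨⟨P, Or.inl rfl⟩, ⟨Q, Or.inl hQ⟩⟩
      · exact ⟨⟨-P, Or.inr (by push_cast; ring)⟩, ⟨-Q, Or.inr (by push_cast; linarith)⟩⟩
    · refine ⟨|P - p 0|, abs_nonneg _, hM, ?_⟩
      rcases abs_cases (P - p 0 : ℝ) with ⟨h, _⟩ | ⟨h, _⟩ <;> rw [h]
      · exact ⟨⟨P, Or.inr rfl⟩, ⟨Q, Or.inl hQ⟩⟩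
      · exact ⟨⟨-P, Or.inl (by push_cast; ring)⟩, ⟨-Q, Or.inr (by push_cast; linarith)⟩⟩

/-- The index of the last box of side `1 / 2` met by the half-line before time `M`. -/
noncomputable def lastBox (α M : ℝ) : ℤ := ⌈2 * M⌉ + ⌈2 * (α * M)⌉ - 2

theorem distNearestInt_two_mul {t : ℝ} (h : distNearestInt t = 0 ∨ distNearestInt t = 1 / 2) :
    ∃ n : ℤ, 2 * t = n := by
  unfold distNearestInt at h
  rcases h with h | h
  · exact ⟨2 * round t, by push_cast; linarith [abs_eq_zero.1 h]⟩
  · rcases (abs_eq (by norm_num)).1 h with h | h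
    · exact ⟨2 * round t + 1, by push_cast; linarith⟩
    · exact ⟨2 * round t - 1, by push_cast; linarith⟩

theorem distNearestInt_mem (t : ℝ) : 0 ≤ distNearestInt t ∧ distNearestInt t ≤ 1 / 2 :=
  ⟨abs_nonneg _, abs_sub_round t⟩

/-- At a boundary point one of `2M` and `2αM` is an integer, so one of the two ceilings equals its
floor while the other exceeds its floor by at most one. -/
theorem lastBox_lt_floor {α M : ℝ} (h : orbitPoint α M ∈ table \ openTable) :
    lastBox α M < ⌊2 * M⌋ + ⌊2 * (α * M)⌋ := by
  have h2 : (∃ n : ℤ, 2 * M = n) ∨ ∃ n : ℤ, 2 * (α * M) = n := by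
    by_contra hcon
    push Not at hcon
    apply h.2
    rw [mem_openTable_iff]
    have e0 : orbitPoint α M 0 = distNearestInt M := by simp [orbitPoint]
    have e1 : orbitPoint α M 1 = distNearestInt (α * M) := by simp [orbitPoint]
    rw [e0, e1]
    have a0 := distNearestInt_mem M
    have a1 := distNearestInt_mem (α * M)
    have key : ∀ t : ℝ, (∀ n : ℤ, 2 * t ≠ n) → distNearestInt t ≠ 0 ∧ distNearestInt t ≠ 1 / 2 := by
      intro t ht
      constructor <;> intro h
      · exact (distNearestInt_two_mul (Or.inl h)).elim ht
      · exact (distNearestInt_two_mul (Or.inr h)).elim ht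
    have b0 := key M hcon.1
    have b1 := key (α * M) hcon.2
    exact ⟨lt_of_le_of_ne a0.1 b0.1.symm, lt_of_le_of_ne a0.2 b0.2,
      lt_of_le_of_ne a1.1 b1.1.symm, lt_of_le_of_ne a1.2 b1.2⟩
  unfold lastBox
  have c0 := Int.ceil_le_floor_add_one (2 * M)
  have c1 := Int.ceil_le_floor_add_one (2 * (α * M))
  rcases h2 with ⟨n, hn⟩ | ⟨n, hn⟩ <;> simp only [hn, Int.ceil_intCast, Int.floor_intCast] at * <;>
    omega

theorem lastBox_nonneg {α M : ℝ} (hα : 0 < α) (hM : 0 < M) : 0 ≤ lastBox α M := by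
  have h1 : 0 < ⌈2 * M⌉ := Int.ceil_pos.2 (by linarith)
  have h2 : 0 < ⌈2 * (α * M)⌉ := Int.ceil_pos.2 (by positivity)
  unfold lastBox; omega

/-- The sum of the two box indices grows along the half-line, and the truncation happens at a change
of box. Hence whether a time is reached depends only on that sum. -/
theorem le_iff_box_le {α M s : ℝ} (hα : 0 < α) (h : orbitPoint α M ∈ table \ openTable)
    {i k : ℤ} (hi : i < 2 * s) (hi' : 2 * s < i + 1) (hk : k < 2 * (α * s))
    (hk' : 2 * (α * s) < k + 1) : s ≤ M ↔ i + k ≤ lastBox α M := by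
  constructor
  · intro hs
    have h1 : i < ⌈2 * M⌉ := by rw [Int.lt_ceil]; linarith
    have h2 : k < ⌈2 * (α * M)⌉ := by rw [Int.lt_ceil]; nlinarith
    unfold lastBox; omega
  · intro hik
    by_contra hs
    push Not at hs
    have h3 := lastBox_lt_floor h
    have h1 : ⌊2 * M⌋ < i + 1 := by rw [Int.floor_lt]; push_cast; linarith
    have h2 : ⌊2 * (α * M)⌋ < k + 1 := by rw [Int.floor_lt]; push_cast; nlinarith
    omega

/-- On the unfolded line `u = αP - Q = (P + Q)α - Q(1 + α)`, so the index of the line is `j = P +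
Q`. The time `P + x` falls in box `2j` and its negative in box `-2j - 2`; for the other family the
boxes are `2j - 1` and `-2j - 1`. Comparing with `lastBox` gives the two index windows. -/
theorem mem_orbit_iff {α M : ℝ} (hα : 0 < α) (h : orbitPoint α M ∈ table \ openTable)
    {p : Plane} (hp : p ∈ openTable) :
    p ∈ orbit α M ↔ coordU α p ∈ linesU α (lastBox α M / 2) ∨
      coordV α p ∈ linesV α ((lastBox α M + 1) / 2) := by
  rw [mem_orbit_iff_exists_int hp]
  obtain ⟨h1, h2, h3, h4⟩ := mem_openTable_iff.1 hp
  have aux : ∀ x : ℝ, |x| ≤ M ↔ x ≤ M ∧ -x ≤ M := fun x => abs_le'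
  refine or_congr ?_ ?_
  · have key : ∀ P Q : ℤ, α * (P + p 0) = Q + p 1 →
        (|P + p 0| ≤ M ↔ -(lastBox α M / 2) - 1 ≤ P + Q ∧ P + Q ≤ lastBox α M / 2) := by
      intro P Q hPQ
      rw [aux, le_iff_box_le hα h (i := 2 * P) (k := 2 * Q) (by push_cast; linarith)
          (by push_cast; linarith) (by push_cast; linarith) (by push_cast; linarith),
        le_iff_box_le hα h (i := -2 * P - 1) (k := -2 * Q - 1) (by push_cast; linarith)
          (by push_cast; linarith) (by push_cast; linarith) (by push_cast; linarith)]
      omega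
    constructor
    · rintro ⟨P, Q, hM, hPQ⟩
      obtain ⟨a, b⟩ := (key P Q hPQ).1 hM
      exact ⟨P + Q, Q, a, b, by unfold coordU; push_cast; linarith⟩
    · rintro ⟨j, q, a, b, hj⟩
      unfold coordU at hj
      have hPQ : α * ((j - q : ℤ) + p 0) = q + p 1 := by push_cast; linarith
      exact ⟨j - q, q, (key _ _ hPQ).2 ⟨by omega, by omega⟩, hPQ⟩
  · have key : ∀ P Q : ℤ, α * (P - p 0) = Q + p 1 →
        (|P - p 0| ≤ M ↔ -((lastBox α M + 1) / 2) ≤ P + Q ∧ P + Q ≤ (lastBox α M + 1) / 2) := by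
      intro P Q hPQ
      rw [aux, le_iff_box_le hα h (i := 2 * P - 1) (k := 2 * Q) (by push_cast; linarith)
          (by push_cast; linarith) (by push_cast; linarith) (by push_cast; linarith),
        le_iff_box_le hα h (i := -2 * P) (k := -2 * Q - 1) (by push_cast; linarith)
          (by push_cast; linarith) (by push_cast; linarith) (by push_cast; linarith)]
      omega
    constructor
    · rintro ⟨P, Q, hM, hPQ⟩
      obtain ⟨a, b⟩ := (key P Q hPQ).1 hM
      exact ⟨P + Q, Q, a, b, by unfold coordV; push_cast; linarith⟩
    · rintro ⟨j, q, a, b, hj⟩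
      unfold coordV at hj
      have hPQ : α * ((j - q : ℤ) - p 0) = q + p 1 := by push_cast; linarith
      exact ⟨j - q, q, (key _ _ hPQ).2 ⟨by omega, by omega⟩, hPQ⟩

theorem bounds_lastBox {α M : ℝ} (hα : 0 < α) (hM : 0 < M) :
    Bounds (lastBox α M / 2) ((lastBox α M + 1) / 2) := by
  have := lastBox_nonneg hα hM
  constructor <;> omega

/-! ### Gaps and cells -/

/-- `(a, b)` is a component of the interval `(lo, hi)` with the points of `A` removed. -/
structure IsGap (A : Set ℝ) (lo hi a b : ℝ) : Prop where
  left : a ∈ A ∨ a = lo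
  right : b ∈ A ∨ b = hi
  lo_le : lo ≤ a
  le_hi : b ≤ hi
  lt : a < b
  notMem : ∀ x ∈ A, a < x → x < b → False

theorem IsGap.eq_of_overlap {A : Set ℝ} {lo hi a b a' b' : ℝ} (h : IsGap A lo hi a b)
    (h' : IsGap A lo hi a' b') (h1 : a < b') (h2 : a' < b) : a = a' ∧ b = b' := by
  have key : ∀ {a b a' b' : ℝ}, IsGap A lo hi a b → IsGap A lo hi a' b' → a < b' → a' < b →
      a' ≤ a ∧ b ≤ b' := by
    intro a b a' b' h h' h1 h2
    constructor
    · by_contra hlt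
      push Not at hlt
      rcases h'.left with h3 | h3
      · exact h.notMem _ h3 hlt h2
      · linarith [h.lo_le]
    · by_contra hlt
      push Not at hlt
      rcases h'.right with h3 | h3
      · exact h.notMem _ h3 h1 hlt
      · linarith [h.le_hi]
  have k1 := key h h' h1 h2
  have k2 := key h' h h2 h1
  exact ⟨le_antisymm k2.1 k1.1, le_antisymm k1.2 k2.2⟩

theorem exists_isGap {A : Set ℝ} {lo hi x : ℝ} (hA : (A ∩ Set.Icc lo hi).Finite) (hx : x ∉ A)
    (h1 : lo < x) (h2 : x < hi) : ∃ a b, IsGap A lo hi a b ∧ a < x ∧ x < b := by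
  obtain ⟨a, ⟨haA, hax⟩, ha⟩ := Set.exists_max_image
    ((insert lo (A ∩ Set.Icc lo hi)) ∩ Set.Iio x) id
    ((hA.insert lo).subset Set.inter_subset_left) ⟨lo, Set.mem_insert _ _, h1⟩
  obtain ⟨b, ⟨hbA, hbx⟩, hb⟩ := Set.exists_min_image
    ((insert hi (A ∩ Set.Icc lo hi)) ∩ Set.Ioi x) id
    ((hA.insert hi).subset Set.inter_subset_left) ⟨hi, Set.mem_insert _ _, h2⟩
  have hlo : lo ≤ a := ha lo ⟨Set.mem_insert _ _, h1⟩
  have hhi : b ≤ hi := hb hi ⟨Set.mem_insert _ _, h2⟩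
  rw [Set.mem_Iio] at hax
  rw [Set.mem_Ioi] at hbx
  refine ⟨a, b, ⟨?_, ?_, hlo, hhi, by linarith, fun y hy hay hyb => ?_⟩, hax, hbx⟩
  · rcases haA with h | h
    · exact Or.inr h
    · exact Or.inl h.1
  · rcases hbA with h | h
    · exact Or.inr h
    · exact Or.inl h.1
  · have hyI : y ∈ A ∩ Set.Icc lo hi := ⟨hy, by linarith, by linarith⟩
    rcases lt_trichotomy y x with h | h | h
    · have := ha y ⟨Set.mem_insert_of_mem _ hyI, h⟩
      simp only [id] at this; linarith
    · exact hx (h ▸ hy)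
    · have := hb y ⟨Set.mem_insert_of_mem _ hyI, h⟩
      simp only [id] at this; linarith

/-- The part of the open table where `coordU` is in `(a, b)` and `coordV` is in `(c, d)`. -/
def cell (α a b c d : ℝ) : Set Plane :=
  {p | p ∈ openTable ∧ (a < coordU α p ∧ coordU α p < b) ∧ (c < coordV α p ∧ coordV α p < d)}

theorem continuous_coordU (α : ℝ) : Continuous (coordU α) := by unfold coordU; fun_prop

theorem continuous_coordV (α : ℝ) : Continuous (coordV α) := by unfold coordV; fun_prop

theorem mem_cell_iff {α a b c d : ℝ} {p : Plane} : p ∈ cell α a b c d ↔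
    (0 < p 0 ∧ p 0 < 1 / 2 ∧ 0 < p 1 ∧ p 1 < 1 / 2) ∧
    (a < p 1 - α * p 0 ∧ p 1 - α * p 0 < b) ∧ (c < p 1 + α * p 0 ∧ p 1 + α * p 0 < d) := by
  rw [cell, Set.mem_ofPred_eq, mem_openTable_iff]; rfl

/-- The four linear functionals whose values are bounded in a cell. -/
noncomputable def slabs (α : ℝ) : Fin 4 → Plane →L[ℝ] ℝ :=
  let x : Plane →L[ℝ] ℝ := EuclideanSpace.proj 0
  let y : Plane →L[ℝ] ℝ := EuclideanSpace.proj 1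
  ![x, y, y - α • x, y + α • x]

theorem cell_eq_slabs (α a b c d : ℝ) : cell α a b c d =
    {p | ∀ i, (![0, 0, a, c] : Fin 4 → ℝ) i < slabs α i p ∧
      slabs α i p < (![1 / 2, 1 / 2, b, d] : Fin 4 → ℝ) i} := by
  ext p
  rw [mem_cell_iff]
  simp [slabs, Fin.forall_fin_succ, and_assoc]

/-! ### Polyhedra cut out by slabs -/

section Polyhedra

variable {E ι : Type*} [NormedAddCommGroup E] [NormedSpace ℝ E] {φ : ι → E →L[ℝ] ℝ}
  {lo hi : ι → ℝ}

theorem convex_openSlabs : Convex ℝ {p | ∀ i, lo i < φ i p ∧ φ i p < hi i} := by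
  have : {p | ∀ i, lo i < φ i p ∧ φ i p < hi i} = ⋂ i, (φ i) ⁻¹' Set.Ioo (lo i) (hi i) := by
    ext p; simp
  rw [this]
  exact convex_iInter fun i => (convex_Ioo (lo i) (hi i)).linear_preimage (φ i).toLinearMap

theorem isOpen_openSlabs [Finite ι] : IsOpen {p | ∀ i, lo i < φ i p ∧ φ i p < hi i} := by
  have : {p | ∀ i, lo i < φ i p ∧ φ i p < hi i} = ⋂ i, (φ i) ⁻¹' Set.Ioo (lo i) (hi i) := by
    ext p; simp
  rw [this]
  exact isOpen_iInter_of_finite fun i => isOpen_Ioo.preimage (φ i).continuous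

theorem convex_closedSlabs : Convex ℝ {p | ∀ i, lo i ≤ φ i p ∧ φ i p ≤ hi i} := by
  have : {p | ∀ i, lo i ≤ φ i p ∧ φ i p ≤ hi i} = ⋂ i, (φ i) ⁻¹' Set.Icc (lo i) (hi i) := by
    ext p; simp
  rw [this]
  exact convex_iInter fun i => (convex_Icc (lo i) (hi i)).linear_preimage (φ i).toLinearMap

theorem isClosed_closedSlabs : IsClosed {p | ∀ i, lo i ≤ φ i p ∧ φ i p ≤ hi i} := by
  have : {p | ∀ i, lo i ≤ φ i p ∧ φ i p ≤ hi i} = ⋂ i, (φ i) ⁻¹' Set.Icc (lo i) (hi i) := by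
    ext p; simp
  rw [this]
  exact isClosed_iInter fun i => isClosed_Icc.preimage (φ i).continuous

theorem closure_openSlabs (hne : {p | ∀ i, lo i < φ i p ∧ φ i p < hi i}.Nonempty) :
    closure {p | ∀ i, lo i < φ i p ∧ φ i p < hi i} = {p | ∀ i, lo i ≤ φ i p ∧ φ i p ≤ hi i} := by
  apply Set.Subset.antisymm
  · exact closure_minimal (fun p hp i => ⟨(hp i).1.le, (hp i).2.le⟩) isClosed_closedSlabs
  · intro q hq
    obtain ⟨p, hp⟩ := hne
    have hlim : Filter.Tendsto (fun t : ℝ => q + t • (p - q)) (nhdsWithin 0 (Set.Ioi 0))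
        (nhds q) := by
      have : Filter.Tendsto (fun t : ℝ => q + t • (p - q)) (nhds 0) (nhds (q + (0 : ℝ) • (p - q))) :=
        (by fun_prop : Continuous fun t : ℝ => q + t • (p - q)).tendsto 0
      rw [zero_smul, add_zero] at this
      exact this.mono_left nhdsWithin_le_nhds
    refine mem_closure_of_tendsto hlim ?_
    have hI : Set.Ioo (0 : ℝ) 1 ∈ nhdsWithin (0 : ℝ) (Set.Ioi 0) := Ioo_mem_nhdsGT one_pos
    filter_upwards [hI] with t ht i
    have h1 := hq i
    have h2 := hp i
    simp only [map_add, map_smul, map_sub, smul_eq_mul]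
    constructor <;> nlinarith [ht.1, ht.2]

/-- An extreme point of a polyhedron is determined by the constraints that are active there. -/
theorem extremePoints_closedSlabs_finite [Finite ι] :
    (Set.extremePoints ℝ {p | ∀ i, lo i ≤ φ i p ∧ φ i p ≤ hi i}).Finite := by
  classical
  refine Set.Finite.of_injOn (f := fun p => ({i | φ i p = lo i}, {i | φ i p = hi i}))
    (t := Set.univ) (fun _ _ => Set.mem_univ _) ?_ Set.finite_univ
  intro p hp q hq hpq
  by_contra hne
  simp only [Prod.mk.injEq, Set.ext_iff, Set.mem_ofPred_eq] at hpq
  obtain ⟨hlo, hhi⟩ := hpq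
  -- Constraints active at `p` are active at `q` as well and so stay constant along the line through
  -- both; the others are strict at `p`. A short move in both directions therefore remains feasible,
  -- against extremality.
  have hev : ∀ᶠ t : ℝ in nhdsWithin 0 (Set.Ioi 0), ∀ i,
      (lo i ≤ φ i (p + t • (q - p)) ∧ φ i (p + t • (q - p)) ≤ hi i) ∧
      (lo i ≤ φ i (p + (-t) • (q - p)) ∧ φ i (p + (-t) • (q - p)) ≤ hi i) := by
    rw [Filter.eventually_all]
    intro i
    have hpi := hp.1 i
    have hlow : ∀ s : ℝ → ℝ, Continuous s → s 0 = 0 → ∀ᶠ t : ℝ in nhds 0,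
        lo i ≤ φ i (p + s t • (q - p)) ∧ φ i (p + s t • (q - p)) ≤ hi i := by
      intro s hs hs0
      have hc : Continuous fun t : ℝ => φ i (p + s t • (q - p)) := by fun_prop
      have ht : Filter.Tendsto (fun t : ℝ => φ i (p + s t • (q - p))) (nhds 0) (nhds (φ i p)) := by
        have := hc.tendsto 0
        simpa [hs0] using this
      refine Filter.Eventually.and ?_ ?_
      · rcases eq_or_lt_of_le hpi.1 with h | h
        · refine Filter.Eventually.of_forall fun t => ?_
          rw [map_add, map_smul, map_sub, (hlo i).1 h.symm, ← h]; simp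
        · exact (ht.eventually (lt_mem_nhds h)).mono fun t h => h.le
      · rcases eq_or_lt_of_le hpi.2 with h | h
        · refine Filter.Eventually.of_forall fun t => ?_
          rw [map_add, map_smul, map_sub, (hhi i).1 h, h]; simp
        · exact (ht.eventually (gt_mem_nhds h)).mono fun t h => h.le
    exact ((hlow id continuous_id rfl).and (hlow (fun t => -t) continuous_neg neg_zero)).filter_mono
      nhdsWithin_le_nhds
  obtain ⟨t, ht, ht0⟩ := (hev.and self_mem_nhdsWithin).exists
  have hseg : p ∈ openSegment ℝ (p + t • (q - p)) (p + (-t) • (q - p)) := by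
    refine ⟨1 / 2, 1 / 2, by norm_num, by norm_num, by norm_num, ?_⟩
    module
  have := hp.2 (fun i => (ht i).1) (fun i => (ht i).2) hseg
  have h0 : t • (q - p) = 0 := by simpa using this
  rcases smul_eq_zero.1 h0 with h | h
  · exact ht0.ne' h
  · exact hne (sub_eq_zero.1 h).symm

/-- Krein–Milman, with no closure needed because the hull of finitely many extreme points is
compact. -/
theorem exists_finite_convexHull_eq [Finite ι]
    (hc : IsCompact {p | ∀ i, lo i ≤ φ i p ∧ φ i p ≤ hi i}) :
    ∃ V : Set E, V.Finite ∧ {p | ∀ i, lo i ≤ φ i p ∧ φ i p ≤ hi i} = convexHull ℝ V := by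
  refine ⟨_, extremePoints_closedSlabs_finite (φ := φ) (lo := lo) (hi := hi), ?_⟩
  have h := closure_convexHull_extremePoints hc convex_closedSlabs
  rwa [(Set.Finite.isCompact_convexHull (𝕜 := ℝ)
    extremePoints_closedSlabs_finite).isClosed.closure_eq, eq_comm] at h

end Polyhedra

/-! ### The pieces are the closures of the cells, and they partition the table -/

theorem convex_cell (α a b c d : ℝ) : Convex ℝ (cell α a b c d) := by
  rw [cell_eq_slabs]; exact convex_openSlabs

theorem isOpen_cell (α a b c d : ℝ) : IsOpen (cell α a b c d) := by
  rw [cell_eq_slabs]; exact isOpen_openSlabs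

theorem isClosed_table : IsClosed table := by
  have : table = ⋂ i, (fun p : Plane => p i) ⁻¹' Set.Icc 0 (1 / 2) := by
    ext p; simp [table]
  rw [this]
  exact isClosed_iInter fun i => isClosed_Icc.preimage (by fun_prop)

theorem isCompact_table : IsCompact table := by
  refine Metric.isCompact_of_isClosed_isBounded isClosed_table ?_
  refine (Metric.isBounded_closedBall (x := (0 : Plane)) (r := 1)).subset fun p hp => ?_
  obtain ⟨h1, h2, h3, h4⟩ := mem_table_iff.1 hp
  rw [mem_closedBall_zero_iff, EuclideanSpace.norm_eq, Real.sqrt_le_one]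
  simp only [Fin.sum_univ_two, Real.norm_eq_abs, sq_abs]
  nlinarith

theorem isConvexPolygon_closure_cell {α a b c d : ℝ} (hne : (cell α a b c d).Nonempty) :
    IsConvexPolygon (closure (cell α a b c d)) := by
  constructor
  · rw [cell_eq_slabs] at hne ⊢
    rw [closure_openSlabs hne]
    refine exists_finite_convexHull_eq ?_
    refine isCompact_table.of_isClosed_subset isClosed_closedSlabs fun p hp => ?_
    have h0 := hp 0
    have h1 := hp 1
    simp only [slabs, Matrix.cons_val_zero, Matrix.cons_val_one, PiLp.proj_apply]
      at h0 h1
    exact mem_table_iff.2 ⟨h0.1, h0.2, h1.1, h1.2⟩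
  · exact hne.mono (interior_maximal subset_closure (isOpen_cell α a b c d))

theorem interior_closure_cell (α a b c d : ℝ) :
    interior (closure (cell α a b c d)) = cell α a b c d := by
  rcases (cell α a b c d).eq_empty_or_nonempty with h | h
  · simp [h]
  · rw [(convex_cell α a b c d).interior_closure_eq_interior_of_nonempty_interior
      (by rwa [(isOpen_cell α a b c d).interior_eq]), (isOpen_cell α a b c d).interior_eq]

theorem coord_bounds {α : ℝ} (hα : 0 < α) {p : Plane} (hp : p ∈ openTable) :
    (-(α / 2) < coordU α p ∧ coordU α p < 1 / 2) ∧
      (0 < coordV α p ∧ coordV α p < (1 + α) / 2) := by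
  obtain ⟨h1, h2, h3, h4⟩ := mem_openTable_iff.1 hp
  unfold coordU coordV
  refine ⟨⟨?_, ?_⟩, ?_, ?_⟩ <;> nlinarith

/-- The image of a connected set is an interval, which cannot pass an end of the gap: that end is
either a forbidden value or a bound of the range. -/
theorem subset_gap_of_isPreconnected {C : Set Plane} (hC : IsPreconnected C) {f : Plane → ℝ}
    (hf : Continuous f) {A : Set ℝ} {lo hi a b : ℝ} (hgap : IsGap A lo hi a b)
    (hA : ∀ q ∈ C, f q ∉ A ∧ lo < f q ∧ f q < hi) {p : Plane} (hp : p ∈ C) (hpa : a < f p)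
    (hpb : f p < b) {q : Plane} (hq : q ∈ C) : a < f q ∧ f q < b := by
  have hord : (f '' C).OrdConnected := (hC.image f hf.continuousOn).ordConnected
  constructor
  · by_contra h
    push Not at h
    obtain ⟨z, hz, hza⟩ := hord.out ⟨q, hq, rfl⟩ ⟨p, hp, rfl⟩ ⟨h, hpa.le⟩
    rcases hgap.left with h | h
    · exact (hA z hz).1 (hza ▸ h)
    · linarith [(hA z hz).2.1]
  · by_contra h
    push Not at h
    obtain ⟨z, hz, hza⟩ := hord.out ⟨p, hp, rfl⟩ ⟨q, hq, rfl⟩ ⟨hpb.le, h⟩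
    rcases hgap.right with h | h
    · exact (hA z hz).1 (hza ▸ h)
    · linarith [(hA z hz).2.2]

/-- The data of a cell of the arrangement of the lines `coordU ∈ A` and `coordV ∈ B`. -/
structure IsCell (α : ℝ) (A B : Set ℝ) (a b c d : ℝ) : Prop where
  gapU : IsGap A (-(α / 2)) (1 / 2) a b
  gapV : IsGap B 0 ((1 + α) / 2) c d
  nonempty : (cell α a b c d).Nonempty

/-- A cell is convex, hence connected, and neither coordinate can leave its gap along a connected
subset of the complement of the lines. -/
theorem connectedComponentIn_eq_cell {α : ℝ} (hα : 0 < α) {A B : Set ℝ} {F : Set Plane}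
    (hF : ∀ p, p ∈ F ↔ p ∈ openTable ∧ coordU α p ∉ A ∧ coordV α p ∉ B) {a b c d : ℝ}
    (hU : IsGap A (-(α / 2)) (1 / 2) a b) (hV : IsGap B 0 ((1 + α) / 2) c d) {p : Plane}
    (hp : p ∈ cell α a b c d) : connectedComponentIn F p = cell α a b c d := by
  have hsub : cell α a b c d ⊆ F := fun q hq => (hF q).2 ⟨hq.1,
    fun h => hU.notMem _ h hq.2.1.1 hq.2.1.2, fun h => hV.notMem _ h hq.2.2.1 hq.2.2.2⟩
  apply Set.Subset.antisymm
  · intro q hq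
    have hC := isPreconnected_connectedComponentIn (F := F) (x := p)
    have hpC := mem_connectedComponentIn (hsub hp)
    have hCF := connectedComponentIn_subset F p
    refine ⟨((hF q).1 (hCF hq)).1,
      subset_gap_of_isPreconnected hC (continuous_coordU α) hU (fun z hz => ?_) hpC hp.2.1.1
        hp.2.1.2 hq,
      subset_gap_of_isPreconnected hC (continuous_coordV α) hV (fun z hz => ?_) hpC hp.2.2.1
        hp.2.2.2 hq⟩
    · have := (hF z).1 (hCF hz)
      exact ⟨this.2.1, (coord_bounds hα this.1).1⟩
    · have := (hF z).1 (hCF hz)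
      exact ⟨this.2.2, (coord_bounds hα this.1).2⟩
  · exact (convex_cell α a b c d).isPreconnected.subset_connectedComponentIn hp hsub

theorem exists_cell {α : ℝ} (hα : 0 < α) {A B : Set ℝ}
    (hA : (A ∩ Set.Icc (-(α / 2)) (1 / 2)).Finite) (hB : (B ∩ Set.Icc 0 ((1 + α) / 2)).Finite)
    {p : Plane} (hp : p ∈ openTable) (h1 : coordU α p ∉ A) (h2 : coordV α p ∉ B) :
    ∃ a b c d, IsCell α A B a b c d ∧ p ∈ cell α a b c d := by
  obtain ⟨hu, hv⟩ := coord_bounds hα hp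
  obtain ⟨a, b, hab, h3⟩ := exists_isGap hA h1 hu.1 hu.2
  obtain ⟨c, d, hcd, h4⟩ := exists_isGap hB h2 hv.1 hv.2
  exact ⟨a, b, c, d, ⟨hab, hcd, p, hp, h3, h4⟩, hp, h3, h4⟩

/-- The pieces of the table cut by the lines `coordU ∈ A` and `coordV ∈ B`. -/
def cells (α : ℝ) (A B : Set ℝ) : Set (Set Plane) :=
  {P | ∃ a b c d, IsCell α A B a b c d ∧ P = closure (cell α a b c d)}

theorem pieces_eq_cells {α M : ℝ} (hα : 0 < α) (h : orbitPoint α M ∈ table \ openTable) :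
    pieces α M = cells α (linesU α (lastBox α M / 2)) (linesV α ((lastBox α M + 1) / 2)) := by
  have hF : ∀ p, p ∈ openTable \ orbit α M ↔ p ∈ openTable ∧
      coordU α p ∉ linesU α (lastBox α M / 2) ∧
      coordV α p ∉ linesV α ((lastBox α M + 1) / 2) := by
    intro p
    constructor
    · rintro ⟨h1, h2⟩
      rw [mem_orbit_iff hα h h1, not_or] at h2
      exact ⟨h1, h2⟩
    · rintro ⟨h1, h2⟩
      refine ⟨h1, ?_⟩
      rwa [mem_orbit_iff hα h h1, not_or]
  ext P
  constructor
  · rintro ⟨p, hp, rfl⟩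
    obtain ⟨h1, h2, h3⟩ := (hF p).1 hp
    obtain ⟨a, b, c, d, hcell, hpc⟩ := exists_cell hα (rotPts_finite hα _ _ _ _)
      (rotPts_finite hα _ _ _ _) h1 h2 h3
    exact ⟨a, b, c, d, hcell, by
      rw [connectedComponentIn_eq_cell hα hF hcell.gapU hcell.gapV hpc]⟩
  · rintro ⟨a, b, c, d, hcell, rfl⟩
    obtain ⟨p, hp⟩ := hcell.nonempty
    refine ⟨p, (hF p).2 ⟨hp.1, fun h => hcell.gapU.notMem _ h hp.2.1.1 hp.2.1.2,
      fun h => hcell.gapV.notMem _ h hp.2.2.1 hp.2.2.2⟩, ?_⟩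
    rw [connectedComponentIn_eq_cell hα hF hcell.gapU hcell.gapV hp]

theorem IsGap.finite {A : Set ℝ} {lo hi : ℝ} (hA : (A ∩ Set.Icc lo hi).Finite) :
    {x : ℝ × ℝ | IsGap A lo hi x.1 x.2}.Finite := by
  refine (((hA.insert lo).prod (hA.insert hi))).subset ?_
  rintro ⟨a, b⟩ h
  have hlt : a < b := h.lt
  refine ⟨?_, ?_⟩
  · rcases h.left with h1 | h1
    · exact Set.mem_insert_of_mem _ ⟨h1, h.lo_le, by linarith [h.le_hi]⟩
    · exact h1 ▸ Set.mem_insert _ _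
  · rcases h.right with h1 | h1
    · exact Set.mem_insert_of_mem _ ⟨h1, by linarith [h.lo_le], h.le_hi⟩
    · exact h1 ▸ Set.mem_insert _ _

theorem table_subset_closure_openTable : table ⊆ closure openTable := by
  -- With slope `1` the bounds `±2` on both coordinates are vacuous, so the results on slabs apply
  -- to the square itself.
  have h : openTable = cell 1 (-2) 2 (-2) 2 := by
    ext p
    rw [mem_openTable_iff, mem_cell_iff]
    constructor
    · rintro ⟨h1, h2, h3, h4⟩
      refine ⟨⟨h1, h2, h3, h4⟩, ⟨?_, ?_⟩, ?_, ?_⟩ <;> linarith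
    · exact fun h => h.1
  have hne : openTable.Nonempty :=
    ⟨!₂[1 / 4, 1 / 4], mem_openTable_iff.2 (by norm_num)⟩
  rw [h, cell_eq_slabs] at hne ⊢
  rw [closure_openSlabs hne]
  intro p hp
  obtain ⟨h1, h2, h3, h4⟩ := mem_table_iff.1 hp
  simp only [slabs, Fin.forall_fin_succ, Set.mem_ofPred_eq]
  simp
  refine ⟨⟨?_, ?_⟩, ⟨?_, ?_⟩, ⟨?_, ?_⟩, ?_, ?_⟩ <;> linarith

theorem dense_compl_line (t c : ℝ) : Dense {p : Plane | p 1 + t * p 0 ≠ c} := by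
  refine (interior_eq_empty_iff_dense_compl (s := {p : Plane | p 1 + t * p 0 = c})).1 ?_
  rw [Set.eq_empty_iff_forall_notMem]
  intro p hp
  have hlim : Filter.Tendsto (fun s : ℝ => p + s • (!₂[0, 1] : Plane)) (nhdsWithin 0 (Set.Ioi 0))
      (nhds p) := by
    have : Filter.Tendsto (fun s : ℝ => p + s • (!₂[0, 1] : Plane)) (nhds 0)
        (nhds (p + (0 : ℝ) • (!₂[0, 1] : Plane))) :=
      (by fun_prop : Continuous fun s : ℝ => p + s • (!₂[0, 1] : Plane)).tendsto 0
    rw [zero_smul, add_zero] at this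
    exact this.mono_left nhdsWithin_le_nhds
  have hev := hlim.eventually (isOpen_interior.mem_nhds hp)
  obtain ⟨s, hs, hs0⟩ := (hev.and self_mem_nhdsWithin).exists
  have key : ∀ q ∈ interior {p : Plane | p 1 + t * p 0 = c}, q 1 + t * q 0 = c := fun q hq => by
    have := interior_subset hq
    exact this
  have h1 := key p hp
  have h2 := key _ hs
  simp at h2 hs0
  linarith

theorem table_subset_closure_compl_lines {α : ℝ} (hα : 0 < α) {A B : Set ℝ}
    (hA : (A ∩ Set.Icc (-(α / 2)) (1 / 2)).Finite) (hB : (B ∩ Set.Icc 0 ((1 + α) / 2)).Finite) :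
    table ⊆ closure {p | p ∈ openTable ∧ coordU α p ∉ A ∧ coordV α p ∉ B} := by
  have hdense : Dense ((⋂ c ∈ A ∩ Set.Icc (-(α / 2)) (1 / 2), {p : Plane | p 1 + (-α) * p 0 ≠ c}) ∩
      ⋂ c ∈ B ∩ Set.Icc 0 ((1 + α) / 2), {p : Plane | p 1 + α * p 0 ≠ c}) := by
    have hopen : ∀ t c : ℝ, IsOpen {p : Plane | p 1 + t * p 0 ≠ c} := fun t c =>
      isOpen_ne_fun (by fun_prop) (by fun_prop)
    have key : ∀ (t : ℝ) {S : Set ℝ}, S.Finite →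
        Dense (⋂ c ∈ S, {p : Plane | p 1 + t * p 0 ≠ c}) := fun t S hS =>
      dense_biInter_of_isOpen (fun c _ => hopen t c) hS.countable fun c _ => dense_compl_line t c
    exact (key _ hA).inter_of_isOpen_left (key _ hB) (hA.isOpen_biInter fun c _ => hopen _ c)
  have hopenT : IsOpen openTable := by
    have : openTable = ⋂ i, (fun p : Plane => p i) ⁻¹' Set.Ioo 0 (1 / 2) := by
      ext p; simp [openTable]
    rw [this]
    exact isOpen_iInter_of_finite fun i => isOpen_Ioo.preimage (by fun_prop)
  refine table_subset_closure_openTable.trans ?_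
  refine (closure_mono (hdense.open_subset_closure_inter hopenT)).trans ?_
  rw [closure_closure]
  refine closure_mono ?_
  rintro p ⟨hp, hpA, hpB⟩
  obtain ⟨hu, hv⟩ := coord_bounds hα hp
  simp only [Set.mem_iInter] at hpA hpB
  refine ⟨hp, fun h => ?_, fun h => ?_⟩
  · exact hpA _ ⟨h, hu.1.le, hu.2.le⟩ (by unfold coordU; ring)
  · exact hpB _ ⟨h, hv.1.le, hv.2.le⟩ rfl

theorem isPolygonPartition_cells {α : ℝ} (hα : 0 < α) {A B : Set ℝ}
    (hA : (A ∩ Set.Icc (-(α / 2)) (1 / 2)).Finite) (hB : (B ∩ Set.Icc 0 ((1 + α) / 2)).Finite) :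
    IsPolygonPartition (cells α A B) table := by
  have hfin : (cells α A B).Finite := by
    refine (((IsGap.finite hA).prod (IsGap.finite hB)).image
      fun x => closure (cell α x.1.1 x.1.2 x.2.1 x.2.2)).subset ?_
    rintro P ⟨a, b, c, d, h, rfl⟩
    exact ⟨((a, b), (c, d)), ⟨h.gapU, h.gapV⟩, rfl⟩
  refine ⟨hfin, ?_, ?_, ?_⟩
  · rintro P ⟨a, b, c, d, h, rfl⟩
    exact isConvexPolygon_closure_cell h.nonempty
  · apply Set.Subset.antisymm
    · rintro p ⟨P, ⟨a, b, c, d, h, rfl⟩, hp⟩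
      refine closure_minimal (fun q hq => ?_) isClosed_table hp
      obtain ⟨h1, h2, h3, h4⟩ := mem_openTable_iff.1 hq.1
      exact mem_table_iff.2 ⟨h1.le, h2.le, h3.le, h4.le⟩
    -- The open cells fill the complement of finitely many lines, which is dense in the table, and a
    -- finite union of closed pieces is closed.
    · refine (table_subset_closure_compl_lines hα hA hB).trans (closure_minimal ?_ ?_)
      · rintro p ⟨hp, h1, h2⟩
        obtain ⟨a, b, c, d, hcell, hpc⟩ := exists_cell hα hA hB hp h1 h2
        exact ⟨_, ⟨a, b, c, d, hcell, rfl⟩, subset_closure hpc⟩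
      · rw [Set.sUnion_eq_biUnion]
        refine hfin.isClosed_biUnion ?_
        rintro P ⟨a, b, c, d, h, rfl⟩
        exact isClosed_closure
  · rintro P ⟨a, b, c, d, h, rfl⟩ Q ⟨a', b', c', d', h', rfl⟩ hne
    rw [interior_closure_cell, interior_closure_cell, Set.disjoint_left]
    intro p hp hp'
    obtain ⟨rfl, rfl⟩ := h.gapU.eq_of_overlap h'.gapU (hp.2.1.1.trans hp'.2.1.2)
      (hp'.2.1.1.trans hp.2.1.2)
    obtain ⟨rfl, rfl⟩ := h.gapV.eq_of_overlap h'.gapV (hp.2.2.1.trans hp'.2.2.2)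
      (hp'.2.2.1.trans hp.2.2.2)
    exact hne rfl

/-! ### Reflection at the walls and its single exception -/

/-- The orbit ends at the point with parameter `e` of a wall, next to the cell `(a, b) × (c, d)`. -/
def WallEnd (A B : Set ℝ) (l r a b c d e : ℝ) : Prop :=
  l < e ∧ e < r ∧ ¬(e ∈ A ↔ e ∈ B) ∧
    ((b = e ∧ c < e ∧ e < d ∧ e ∈ A) ∨ (c = e ∧ a < e ∧ e < b ∧ e ∉ A))

/-- Membership of `e` in `A` decides which alternative holds, so it is the same for both cells: in
one family both gaps have the same end at `e`, in the other both contain `e`. -/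
theorem WallEnd.overlap {A B : Set ℝ} {l r a b c d a' b' c' d' e : ℝ}
    (h : WallEnd A B l r a b c d e) (h' : WallEnd A B l r a' b' c' d' e) (hab : a < b)
    (hcd : c < d) (hab' : a' < b') (hcd' : c' < d') : (a < b' ∧ a' < b) ∧ c < d' ∧ c' < d := by
  obtain ⟨-, -, -, h⟩ := h
  obtain ⟨-, -, -, h'⟩ := h'
  rcases h with ⟨h1, h2, h3, h4⟩ | ⟨h1, h2, h3, h4⟩ <;>
    rcases h' with ⟨h1', h2', h3', h4'⟩ | ⟨h1', h2', h3', h4'⟩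
  · refine ⟨⟨?_, ?_⟩, ?_, ?_⟩ <;> linarith
  · exact absurd h4 h4'
  · exact absurd h4' h4
  · refine ⟨⟨?_, ?_⟩, ?_, ?_⟩ <;> linarith

/-- The cells that meet a wall `u = v`, `l < u < r`, along which the lines `u ∈ A` and `v ∈ B` are
reflected into each other with at most one exception. -/
theorem wall_cases {A B : Set ℝ} {l r a b c d : ℝ}
    (hex : ∀ x y, l ≤ x → x ≤ r → l ≤ y → y ≤ r → ¬(x ∈ A ↔ x ∈ B) → ¬(y ∈ A ↔ y ∈ B) → x = y)
    (ha : a ∈ A ∨ a < l) (hb : b ∈ A ∨ b = r) (hbr : b ≤ r) (hc : c ∈ B ∨ c = l) (hlc : l ≤ c)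
    (hd : d ∈ B ∨ r < d) (hA : ∀ x ∈ A, a < x → x < b → False)
    (hB : ∀ x ∈ B, c < x → x < d → False) (hcut : c < b) (had : a < d) :
    (c ≤ a ∧ d ≤ b ∧ (Consec A a d ∨ Consec B a d)) ∨ (b = r ∧ c < r ∧ r < d) ∨
      (c = l ∧ a < l ∧ l < b) ∨ ∃ e, WallEnd A B l r a b c d e := by
  -- If `c` is interior to the first gap it is not in `A`; so either it is the end `l` of the wall
  -- or it belongs to `B` alone and is the exceptional point. The case `b < d` below is the mirror
  -- image.
  by_cases hac : a < c
  · have hcA : c ∉ A := fun h => hA c h hac hcut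
    rcases hc with hc | hc
    · by_cases hcl : c = l
      · exact Or.inr (Or.inr (Or.inl ⟨hcl, by linarith, by linarith⟩))
      · exact Or.inr (Or.inr (Or.inr ⟨c, lt_of_le_of_ne hlc (Ne.symm hcl), by linarith,
          fun h => hcA (h.2 hc), Or.inr ⟨rfl, hac, hcut, hcA⟩⟩))
    · exact Or.inr (Or.inr (Or.inl ⟨hc, by linarith, by linarith⟩))
  push Not at hac
  by_cases hbd : b < d
  · have hbB : b ∉ B := fun h => hB b h hcut hbd
    by_cases hbr' : b = r
    · exact Or.inr (Or.inl ⟨hbr', by linarith, by linarith⟩)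
    · have hbA : b ∈ A := hb.resolve_right hbr'
      exact Or.inr (Or.inr (Or.inr ⟨b, by linarith, lt_of_le_of_ne hbr hbr',
        fun h => hbB (h.1 hbA), Or.inl ⟨rfl, hcut, hbd, hbA⟩⟩))
  push Not at hbd
  refine Or.inl ⟨hac, hbd, ?_⟩
  have haA : a ∈ A := ha.resolve_right (by linarith)
  have hdB : d ∈ B := hd.resolve_right (by linarith)
  have hconA : d ∈ A → Consec A a d := fun hdA => ⟨haA, hdA, had, fun x hx hax => by
    by_contra hxd
    exact hA x hx hax (by linarith)⟩
  have hconB : a ∈ B → Consec B a d := fun haB => ⟨haB, hdB, had, fun x hx hax => by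
    by_contra hxd
    exact hB x hx (by linarith) (by linarith)⟩
  -- Only one of `a` and `d` can be exceptional, so at least one of the two families contains both
  -- and has them as neighbours.
  by_cases hdA : d ∈ A
  · exact Or.inl (hconA hdA)
  by_cases haB : a ∈ B
  · exact Or.inr (hconB haB)
  exact absurd (hex a d (by linarith) (by linarith) (by linarith) (by linarith)
    (fun h => haB (h.1 haA)) (fun h => hdA (h.2 hdB))) had.ne

/-- The reflection of a set of reals that exchanges `0` and `t`. -/
def reflSet (t : ℝ) (A : Set ℝ) : Set ℝ := {x | t - x ∈ A}

theorem mem_reflSet {t x : ℝ} {A : Set ℝ} : x ∈ reflSet t A ↔ t - x ∈ A := Iff.rfl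

theorem Consec.of_reflSet {t a b : ℝ} {A : Set ℝ} (h : Consec (reflSet t A) a b) :
    Consec A (t - b) (t - a) := by
  refine ⟨h.2.1, h.1, by linarith [h.2.2.1], fun x hx hbx => ?_⟩
  by_contra hxa
  have := h.2.2.2 (t - x) (by rw [mem_reflSet, sub_sub_cancel]; exact hx) (by linarith)
  linarith

/-- The four walls of the table. -/
inductive Wall
  | left
  | top
  | bottom
  | right

namespace Wall

/-- The lines `coordU ∈ A` in the coordinates of a wall. -/
def setU (A : Set ℝ) : Wall → Set ℝ
  | left => A
  | top => A
  | bottom => reflSet 0 A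
  | right => reflSet 0 A

/-- The lines `coordV ∈ B` in the coordinates of a wall. -/
def setV (α : ℝ) (B : Set ℝ) : Wall → Set ℝ
  | left => B
  | top => reflSet 1 B
  | bottom => B
  | right => reflSet α B

/-- The parameter of the end of a wall that lies on the main diagonal. -/
noncomputable def lower (α : ℝ) : Wall → ℝ
  | left => 0
  | top => (1 - α) / 2
  | bottom => 0
  | right => (α - 1) / 2

/-- The parameter of the other end of a wall. -/
noncomputable def upper (α : ℝ) : Wall → ℝ
  | left => 1 / 2
  | top => 1 / 2
  | bottom => α / 2
  | right => α / 2

/-- The value of `coordV` at a point of a wall. -/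
def toV (α x : ℝ) : Wall → ℝ
  | left => x
  | top => 1 - x
  | bottom => x
  | right => α - x

/-- The sign that tells the left and top walls from the others. -/
def sign : Wall → ℝ
  | left => -1
  | top => -1
  | bottom => 1
  | right => 1

/-- The orbit ends at the point with parameter `e` of the wall, next to the given cell. -/
def EndCell (α : ℝ) (A B : Set ℝ) (a b c d e : ℝ) : Wall → Prop
  | left => WallEnd A B 0 (1 / 2) a b c d e
  | top => WallEnd A (reflSet 1 B) ((1 - α) / 2) (1 / 2) a b (1 - d) (1 - c) e
  | bottom => WallEnd (reflSet 0 A) B 0 (α / 2) (0 - b) (0 - a) c d e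
  | right => WallEnd (reflSet 0 A) (reflSet α B) ((α - 1) / 2) (α / 2) (0 - b) (0 - a)
      (α - d) (α - c) e

end Wall

theorem eq_zero_of_eq_int_mul {x L : ℝ} (h : |x| < L) {q : ℤ} (hq : x = q * L) : x = 0 := by
  have hL : 0 < L := (abs_nonneg x).trans_lt h
  rcases lt_trichotomy x 0 with h0 | h0 | h0
  · refine absurd ?_ (int_mul_ne (x := -x) (by linarith) (by rwa [abs_of_neg h0] at h) (-q))
    push_cast; linarith
  · exact h0
  · exact absurd hq (int_mul_ne h0 (by rwa [abs_of_pos h0] at h) q)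

/-- The multiples of `1 + α` away from `jα`. -/
abbrev rotClass (α : ℝ) (j : ℤ) : Set ℝ := rotPts α j j

theorem rotClass_sub {α x y : ℝ} {j : ℤ} (hx : x ∈ rotClass α j) (hy : y ∈ rotClass α j) :
    ∃ q : ℤ, x - y = q * (1 + α) := by
  obtain ⟨i, q, h1, h2, rfl⟩ := hx
  obtain ⟨i', q', h1', h2', rfl⟩ := hy
  obtain rfl : i = j := by omega
  obtain rfl : i' = i := by omega
  exact ⟨q' - q, by push_cast; ring⟩

/-- Bookkeeping of indices: if `x` has index `m`, then `y` has index `σm + s` and `z` has index `σ'm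
+ s'`. When `y` falls outside its window, the hypothesis `h` leaves only indices `m` that give `z`
the index `i`. -/
theorem mem_rotClass_of_notMem {α x y z : ℝ} {lo hi lo' hi' i : ℤ} (σ s t σ' s' t' : ℤ)
    (hx : x ∈ rotPts α lo hi) (hyn : y ∉ rotPts α lo' hi')
    (h : ∀ m : ℤ, lo ≤ m → m ≤ hi → (lo' ≤ σ * m + s ∧ σ * m + s ≤ hi') ∨ σ' * m + s' = i)
    (hy : y = σ * x + s * α - t * (1 + α)) (hz : z = σ' * x + s' * α - t' * (1 + α)) :
    z ∈ rotClass α i := by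
  obtain ⟨m, q, h1, h2, rfl⟩ := hx
  rcases h m h1 h2 with hm | hm
  · exact absurd ⟨σ * m + s, σ * q + t, hm.1, hm.2, by rw [hy]; push_cast; ring⟩ hyn
  · exact ⟨σ' * m + s', σ' * q + t', hm.ge, hm.le, by rw [hz]; push_cast; ring⟩

/-- The points of the walls where the lines of the two families are not reflected into each other
all come from a single class of the rotation. -/
theorem exception_mem (α : ℝ) {k k' : ℤ} (hk : Bounds k k') : ∃ κ : ℝ, (κ = 1 ∨ κ = -1) ∧
    ∀ (w : Wall) (x : ℝ), ¬(x ∈ w.setU (linesU α k) ↔ x ∈ w.setV α (linesV α k')) →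
      κ * (w.sign * w.toV α x) ∈ rotClass α (k + 1) := by
  have hk0 := hk.nonneg
  rcases hk.alt with rfl | rfl
  -- The windows are `-k-1..k` and `-k..k`. On the left wall the unmatched index is `-k-1`, and the
  -- sign `-1` of that wall turns it into `k+1`. On the other walls the reflections in `0`, `1`, `α`
  -- send an index `j` to `-j`, `-j-1`, `1-j`, and again one index is unmatched.
  · refine ⟨1, Or.inl rfl, ?_⟩
    rintro (_ | _ | _ | _) x hx <;>
      simp only [Wall.setU, Wall.setV, Wall.sign, Wall.toV, mem_reflSet, zero_sub] at hx ⊢ <;>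
      rcases (xor_iff_not_iff _ _).2 hx with ⟨h1, h2⟩ | ⟨h1, h2⟩
    · exact mem_rotClass_of_notMem 1 0 0 (-1) 0 0 h1 h2 (by omega) (by push_cast; ring)
        (by push_cast; ring)
    · exact mem_rotClass_of_notMem 1 0 0 (-1) 0 0 h1 h2 (by omega) (by push_cast; ring)
        (by push_cast; ring)
    · exact mem_rotClass_of_notMem (-1) (-1) (-1) 1 1 1 h1 h2 (by omega) (by push_cast; ring)
        (by push_cast; ring)
    · exact mem_rotClass_of_notMem (-1) (-1) (-1) (-1) 0 0 h1 h2 (by omega) (by push_cast; ring)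
        (by push_cast; ring)
    · exact mem_rotClass_of_notMem (-1) 0 0 (-1) 0 0 h1 h2 (by omega) (by push_cast; ring)
        (by push_cast; ring)
    · exact mem_rotClass_of_notMem (-1) 0 0 1 0 0 h1 h2 (by omega) (by push_cast; ring)
        (by push_cast; ring)
    · exact mem_rotClass_of_notMem 1 1 0 1 1 0 h1 h2 (by omega) (by push_cast; ring)
        (by push_cast; ring)
    · exact mem_rotClass_of_notMem 1 (-1) 0 1 0 0 h1 h2 (by omega) (by push_cast; ring)
        (by push_cast; ring)
  -- Now the second window is `-k-1..k+1`; the surplus lies with `linesV`, at the opposite end,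
  -- whence the opposite sign `κ`.
  · refine ⟨-1, Or.inr rfl, ?_⟩
    rintro (_ | _ | _ | _) x hx <;>
      simp only [Wall.setU, Wall.setV, Wall.sign, Wall.toV, mem_reflSet, zero_sub] at hx ⊢ <;>
      rcases (xor_iff_not_iff _ _).2 hx with ⟨h1, h2⟩ | ⟨h1, h2⟩
    · exact mem_rotClass_of_notMem 1 0 0 1 0 0 h1 h2 (by omega) (by push_cast; ring)
        (by push_cast; ring)
    · exact mem_rotClass_of_notMem 1 0 0 1 0 0 h1 h2 (by omega) (by push_cast; ring)
        (by push_cast; ring)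
    · exact mem_rotClass_of_notMem (-1) (-1) (-1) (-1) (-1) (-1) h1 h2 (by omega) (by push_cast; ring)
        (by push_cast; ring)
    · exact mem_rotClass_of_notMem (-1) (-1) (-1) 1 0 0 h1 h2 (by omega) (by push_cast; ring)
        (by push_cast; ring)
    · exact mem_rotClass_of_notMem (-1) 0 0 1 0 0 h1 h2 (by omega) (by push_cast; ring)
        (by push_cast; ring)
    · exact mem_rotClass_of_notMem (-1) 0 0 (-1) 0 0 h1 h2 (by omega) (by push_cast; ring)
        (by push_cast; ring)
    · exact mem_rotClass_of_notMem 1 1 0 (-1) (-1) 0 h1 h2 (by omega) (by push_cast; ring)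
        (by push_cast; ring)
    · exact mem_rotClass_of_notMem 1 (-1) 0 (-1) 0 0 h1 h2 (by omega) (by push_cast; ring)
        (by push_cast; ring)

theorem exception_eq {α : ℝ} (hα : 0 < α) {k k' : ℤ} (hk : Bounds k k') (w : Wall) {x y : ℝ}
    (hx : w.lower α ≤ x) (hx' : x ≤ w.upper α) (hy : w.lower α ≤ y) (hy' : y ≤ w.upper α)
    (h : ¬(x ∈ w.setU (linesU α k) ↔ x ∈ w.setV α (linesV α k')))
    (h' : ¬(y ∈ w.setU (linesU α k) ↔ y ∈ w.setV α (linesV α k'))) : x = y := by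
  obtain ⟨κ, hκ, hE⟩ := exception_mem α hk
  obtain ⟨q, hq⟩ := rotClass_sub (hE w x h) (hE w y h')
  have h0 := eq_zero_of_eq_int_mul (L := 1 + α) ?_ hq
  · rcases hκ with rfl | rfl <;> cases w <;> simp only [Wall.sign, Wall.toV] at h0 <;> linarith
  · rw [abs_lt]
    rcases hκ with rfl | rfl <;> cases w <;>
      simp only [Wall.lower, Wall.upper, Wall.sign, Wall.toV] at hx hx' hy hy' ⊢ <;>
      constructor <;> linarith

/-- The values `sign * toV` on the top, left, bottom and right walls fill, in this order, adjacent
intervals between `-(1 + α) / 2` and `(1 + α) / 2`. This is one period, so a single residue class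
meets the interior of at most one wall. -/
theorem exception_wall_eq {α : ℝ} (hα : 0 < α) {k k' : ℤ} (hk : Bounds k k') {w w' : Wall} {x y : ℝ}
    (hx : w.lower α < x) (hx' : x < w.upper α) (hy : w'.lower α < y) (hy' : y < w'.upper α)
    (h : ¬(x ∈ w.setU (linesU α k) ↔ x ∈ w.setV α (linesV α k')))
    (h' : ¬(y ∈ w'.setU (linesU α k) ↔ y ∈ w'.setV α (linesV α k'))) : w = w' := by
  obtain ⟨κ, hκ, hE⟩ := exception_mem α hk
  obtain ⟨q, hq⟩ := rotClass_sub (hE w x h) (hE w' y h')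
  have h0 := eq_zero_of_eq_int_mul (L := 1 + α) ?_ hq
  · rcases hκ with rfl | rfl <;> cases w <;> cases w' <;>
      simp only [Wall.lower, Wall.upper, Wall.sign, Wall.toV, reduceCtorEq] at hx hx' hy hy' h0 ⊢ <;>
      linarith
  · rw [abs_lt]
    rcases hκ with rfl | rfl <;> cases w <;> cases w' <;>
      simp only [Wall.lower, Wall.upper, Wall.sign, Wall.toV] at hx hx' hy hy' ⊢ <;>
      constructor <;> linarith

theorem Wall.EndCell.exception {α : ℝ} {A B : Set ℝ} {a b c d e : ℝ} {w : Wall}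
    (h : w.EndCell α A B a b c d e) :
    w.lower α < e ∧ e < w.upper α ∧ ¬(e ∈ w.setU A ↔ e ∈ w.setV α B) := by
  cases w <;> exact ⟨h.1, h.2.1, h.2.2.1⟩

theorem Wall.EndCell.overlap {α : ℝ} {A B : Set ℝ} {a b c d a' b' c' d' e : ℝ} {w : Wall}
    (h : w.EndCell α A B a b c d e) (h' : w.EndCell α A B a' b' c' d' e)
    (hab : a < b) (hcd : c < d) (hab' : a' < b') (hcd' : c' < d') :
    (a < b' ∧ a' < b) ∧ c < d' ∧ c' < d := by
  cases w
  · exact WallEnd.overlap h h' hab hcd hab' hcd'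
  · have := WallEnd.overlap h h' hab (by linarith) hab' (by linarith)
    refine ⟨⟨?_, ?_⟩, ?_, ?_⟩ <;> linarith [this.1.1, this.1.2, this.2.1, this.2.2]
  · have := WallEnd.overlap h h' (by linarith) hcd (by linarith) hcd'
    refine ⟨⟨?_, ?_⟩, ?_, ?_⟩ <;> linarith [this.1.1, this.1.2, this.2.1, this.2.2]
  · have := WallEnd.overlap h h' (by linarith) (by linarith) (by linarith) (by linarith)
    refine ⟨⟨?_, ?_⟩, ?_, ?_⟩ <;> linarith [this.1.1, this.1.2, this.2.1, this.2.2]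

/-! ### Classification of the cells -/

theorem mem_openTable_iff_coord {α : ℝ} (hα : 0 < α) {p : Plane} :
    p ∈ openTable ↔ coordU α p < coordV α p ∧ coordV α p - coordU α p < α ∧
      0 < coordU α p + coordV α p ∧ coordU α p + coordV α p < 1 := by
  rw [mem_openTable_iff]
  unfold coordU coordV
  constructor
  · rintro ⟨h1, h2, h3, h4⟩
    refine ⟨?_, ?_, ?_, ?_⟩ <;> nlinarith
  · rintro ⟨h1, h2, h3, h4⟩
    refine ⟨?_, ?_, ?_, ?_⟩
    · by_contra h; push Not at h; nlinarith
    · by_contra h; push Not at h; nlinarith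
    · linarith
    · linarith

theorem mem_cell_iff_coord {α : ℝ} (hα : 0 < α) {a b c d : ℝ} {p : Plane} :
    p ∈ cell α a b c d ↔ (coordU α p < coordV α p ∧ coordV α p - coordU α p < α ∧
      0 < coordU α p + coordV α p ∧ coordU α p + coordV α p < 1) ∧
      (a < coordU α p ∧ coordU α p < b) ∧ (c < coordV α p ∧ coordV α p < d) := by
  rw [← mem_openTable_iff_coord hα]; rfl

/-- The lengths of the gaps between consecutive parallel lines. -/
def IsLen (α : ℝ) (k k' : ℤ) (g : ℝ) : Prop :=
  ∃ a b, (Consec (linesU α k) a b ∨ Consec (linesV α k') a b) ∧ g = b - a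

/-- The preimage of a triangle under the coordinates of a wall. -/
def wallTri (α s t : ℝ) : Wall → Set Plane
  | .left => {p | s < coordU α p ∧ coordU α p < coordV α p ∧ coordV α p < t}
  | .top => {p | s < coordU α p ∧ coordU α p < 1 - coordV α p ∧ 1 - coordV α p < t}
  | .bottom => {p | s < -coordU α p ∧ -coordU α p < coordV α p ∧ coordV α p < t}
  | .right => {p | s < -coordU α p ∧ -coordU α p < α - coordV α p ∧ α - coordV α p < t}

/-- A parallelogram bounded by two lines of each family. -/
def box (α a b c d : ℝ) : Set Plane :=
  {p | (a < coordU α p ∧ coordU α p < b) ∧ (c < coordV α p ∧ coordV α p < d)}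

/-- The cells at the corners other than the origin. -/
def CornerCell (α a b c d : ℝ) : Fin 3 → Prop :=
  ![b = 1 / 2 ∧ c < 1 / 2 ∧ 1 / 2 < d, a = -(α / 2) ∧ c < α / 2 ∧ α / 2 < d,
    d = (1 + α) / 2 ∧ a < (1 - α) / 2 ∧ (1 - α) / 2 < b]

/-- The lines through the starting corner: no gap contains `0` in its interior, so the origin
produces no exceptional cell and only three corners count. -/
theorem zero_mem_linesU {α : ℝ} {k : ℤ} (hk : 0 ≤ k) : (0 : ℝ) ∈ linesU α k :=
  ⟨0, 0, by omega, by omega, by simp⟩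

theorem zero_mem_linesV {α : ℝ} {k : ℤ} (hk : 0 ≤ k) : (0 : ℝ) ∈ linesV α k :=
  ⟨0, 0, by omega, by omega, by simp⟩

/-- The tests `c < b`, `1 < b + d`, `a + c < 0` and `α < d - a` ask whether the box sticks out over
the left, top, bottom or right wall. At the first wall that is crossed, `wall_cases` yields a
triangle, a corner or the end of the orbit. -/
theorem cell_cases {α : ℝ} (hα : 0 < α) {k k' : ℤ} (hk : Bounds k k') {a b c d : ℝ}
    (h : IsCell α (linesU α k) (linesV α k') a b c d) :
    (IsLen α k k' (b - a) ∧ IsLen α k k' (d - c) ∧ cell α a b c d = box α a b c d) ∨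
    (∃ w s t, IsLen α k k' (t - s) ∧ cell α a b c d = wallTri α s t w) ∨
    (∃ i, CornerCell α a b c d i) ∨
    ∃ w e, Wall.EndCell α (linesU α k) (linesV α k') a b c d e w := by
  obtain ⟨p, hp⟩ := h.nonempty
  obtain ⟨⟨hp1, hp2, hp3, hp4⟩, ⟨hpa, hpb⟩, hpc, hpd⟩ := (mem_cell_iff_coord hα).1 hp
  have hk0 := hk.nonneg
  have hk0' : 0 ≤ k' := by rcases hk.alt with h | h <;> omega
  obtain ⟨ha, hb, hla, hbu, hab, hA⟩ := h.gapU
  obtain ⟨hc, hd, hlc, hdu, hcd, hB⟩ := h.gapV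
  have hc' : c ∈ linesV α k' := hc.elim id fun h => h ▸ zero_mem_linesV hk0'
  by_cases hleft : c < b
  · rcases wall_cases (A := linesU α k) (B := linesV α k') (l := 0) (r := 1 / 2)
      (fun x y h1 h2 h3 h4 h5 h6 => exception_eq hα hk .left h1 h2 h3 h4 h5 h6)
      (ha.imp_right fun h => by linarith) hb hbu (Or.inl hc') hlc
      (hd.imp_right fun h => by linarith) hA hB hleft (by linarith) with
      ⟨hca, hdb, hcon⟩ | h1 | h1 | h1
    · right; left
      -- Needed so that the triangle fits between its wall and the opposite one; otherwise it would
      -- not be the whole cell.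
      have hle : d - a ≤ α ∧ d - a ≤ 1 := by
        rcases hcon with h | h
        · exact h.le_of_linesU hα hla (by linarith)
        · exact h.le_of_linesV hα (by linarith) hdu
      refine ⟨.left, a, d, ⟨_, _, hcon, rfl⟩, ?_⟩
      ext q
      rw [mem_cell_iff_coord hα]
      constructor
      · rintro ⟨⟨h1, h2, h3, h4⟩, ⟨h5, h6⟩, h7, h8⟩
        exact ⟨h5, h1, h8⟩
      · rintro ⟨h1, h2, h3⟩
        refine ⟨⟨?_, ?_, ?_, ?_⟩, ⟨?_, ?_⟩, ?_, ?_⟩ <;> linarith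
    · exact Or.inr (Or.inr (Or.inl ⟨0, h1⟩))
    · exact (hA 0 (zero_mem_linesU hk0) h1.2.1 h1.2.2).elim
    · exact Or.inr (Or.inr (Or.inr ⟨.left, h1⟩))
  by_cases htop : 1 < b + d
  · rcases wall_cases (A := linesU α k) (B := reflSet 1 (linesV α k')) (l := (1 - α) / 2)
      (r := 1 / 2) (a := a) (b := b) (c := 1 - d) (d := 1 - c)
      (fun x y h1 h2 h3 h4 h5 h6 => exception_eq hα hk .top h1 h2 h3 h4 h5 h6)
      (ha.imp_right fun h => by linarith) hb hbu
      (hd.imp (fun h => by rwa [mem_reflSet, sub_sub_cancel]) fun h => by linarith) (by linarith)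
      (Or.inl (by rwa [mem_reflSet, sub_sub_cancel])) hA
      (fun x hx h1 h2 => hB _ hx (by linarith) (by linarith)) (by linarith) (by linarith) with
      ⟨hca, hdb, hcon⟩ | h1 | h1 | h1
    · right; left
      have hle : (1 - c) - a ≤ α ∧ (1 - c) - a ≤ 1 := by
        rcases hcon with h | h
        · exact h.le_of_linesU hα hla (by linarith)
        · have := h.of_reflSet.le_of_linesV hα (by linarith) (by linarith)
          constructor <;> linarith
      refine ⟨.top, a, 1 - c, ?_, ?_⟩
      · rcases hcon with h | h
        · exact ⟨_, _, Or.inl h, rfl⟩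
        · exact ⟨_, _, Or.inr h.of_reflSet, by ring⟩
      ext q
      rw [mem_cell_iff_coord hα]
      constructor
      · rintro ⟨⟨h1, h2, h3, h4⟩, ⟨h5, h6⟩, h7, h8⟩
        exact ⟨h5, by linarith, by linarith⟩
      · rintro ⟨h1, h2, h3⟩
        refine ⟨⟨?_, ?_, ?_, ?_⟩, ⟨?_, ?_⟩, ?_, ?_⟩ <;> linarith
    · exact Or.inr (Or.inr (Or.inl ⟨0, h1.1, by linarith, by linarith⟩))
    · exact Or.inr (Or.inr (Or.inl ⟨2, by linarith, h1.2.1, h1.2.2⟩))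
    · exact Or.inr (Or.inr (Or.inr ⟨.top, h1⟩))
  by_cases hbot : a + c < 0
  · rcases wall_cases (A := reflSet 0 (linesU α k)) (B := linesV α k') (l := 0)
      (r := α / 2) (a := 0 - b) (b := 0 - a) (c := c) (d := d)
      (fun x y h1 h2 h3 h4 h5 h6 => exception_eq hα hk .bottom h1 h2 h3 h4 h5 h6)
      (hb.imp (fun h => by rwa [mem_reflSet, sub_sub_cancel]) fun h => by linarith)
      (ha.imp (fun h => by rwa [mem_reflSet, sub_sub_cancel]) fun h => by linarith) (by linarith)
      (Or.inl hc') hlc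
      (hd.imp_right fun h => by linarith)
      (fun x hx h1 h2 => hA _ hx (by linarith) (by linarith)) hB (by linarith) (by linarith) with
      ⟨hca, hdb, hcon⟩ | h1 | h1 | h1
    · right; left
      have hle : d - (0 - b) ≤ α ∧ d - (0 - b) ≤ 1 := by
        rcases hcon with h | h
        · have := h.of_reflSet.le_of_linesU hα (by linarith) (by linarith)
          constructor <;> linarith
        · exact h.le_of_linesV hα (by linarith) hdu
      refine ⟨.bottom, 0 - b, d, ?_, ?_⟩
      · rcases hcon with h | h
        · exact ⟨_, _, Or.inl h.of_reflSet, by ring⟩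
        · exact ⟨_, _, Or.inr h, by ring⟩
      ext q
      rw [mem_cell_iff_coord hα]
      constructor
      · rintro ⟨⟨h1, h2, h3, h4⟩, ⟨h5, h6⟩, h7, h8⟩
        exact ⟨by linarith, by linarith, by linarith⟩
      · rintro ⟨h1, h2, h3⟩
        refine ⟨⟨?_, ?_, ?_, ?_⟩, ⟨?_, ?_⟩, ?_, ?_⟩ <;> linarith
    · exact Or.inr (Or.inr (Or.inl ⟨1, by linarith, by linarith, by linarith⟩))
    · exact (hA 0 (zero_mem_linesU hk0) (by linarith) (by linarith)).elim
    · exact Or.inr (Or.inr (Or.inr ⟨.bottom, h1⟩))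
  by_cases hright : α < d - a
  · rcases wall_cases (A := reflSet 0 (linesU α k)) (B := reflSet α (linesV α k'))
      (l := (α - 1) / 2) (r := α / 2) (a := 0 - b) (b := 0 - a) (c := α - d) (d := α - c)
      (fun x y h1 h2 h3 h4 h5 h6 => exception_eq hα hk .right h1 h2 h3 h4 h5 h6)
      (hb.imp (fun h => by rwa [mem_reflSet, sub_sub_cancel]) fun h => by linarith)
      (ha.imp (fun h => by rwa [mem_reflSet, sub_sub_cancel]) fun h => by linarith) (by linarith)
      (hd.imp (fun h => by rwa [mem_reflSet, sub_sub_cancel]) fun h => by linarith) (by linarith)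
      (Or.inl (by rwa [mem_reflSet, sub_sub_cancel]))
      (fun x hx h1 h2 => hA _ hx (by linarith) (by linarith))
      (fun x hx h1 h2 => hB _ hx (by linarith) (by linarith)) (by linarith) (by linarith) with
      ⟨hca, hdb, hcon⟩ | h1 | h1 | h1
    · right; left
      have hle : (α - c) - (0 - b) ≤ α ∧ (α - c) - (0 - b) ≤ 1 := by
        rcases hcon with h | h
        · have := h.of_reflSet.le_of_linesU hα (by linarith) (by linarith)
          constructor <;> linarith
        · have := h.of_reflSet.le_of_linesV hα (by linarith) (by linarith)
          constructor <;> linarith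
      refine ⟨.right, 0 - b, α - c, ?_, ?_⟩
      · rcases hcon with h | h
        · exact ⟨_, _, Or.inl h.of_reflSet, by ring⟩
        · exact ⟨_, _, Or.inr h.of_reflSet, by ring⟩
      ext q
      rw [mem_cell_iff_coord hα]
      constructor
      · rintro ⟨⟨h1, h2, h3, h4⟩, ⟨h5, h6⟩, h7, h8⟩
        exact ⟨by linarith, by linarith, by linarith⟩
      · rintro ⟨h1, h2, h3⟩
        refine ⟨⟨?_, ?_, ?_, ?_⟩, ⟨?_, ?_⟩, ?_, ?_⟩ <;> linarith
    · exact Or.inr (Or.inr (Or.inl ⟨1, by linarith, by linarith, by linarith⟩))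
    · exact Or.inr (Or.inr (Or.inl ⟨2, by linarith, by linarith, by linarith⟩))
    · exact Or.inr (Or.inr (Or.inr ⟨.right, h1⟩))
  left
  -- An end of the coordinate range occurs only at a corner of the table, so a box that crosses no
  -- wall is bounded by genuine lines on all sides.
  have ha' : a ∈ linesU α k := ha.resolve_right fun h => by linarith
  have hb' : b ∈ linesU α k := hb.resolve_right fun h => by linarith
  have hd' : d ∈ linesV α k' := hd.resolve_right fun h => by linarith
  refine ⟨⟨a, b, Or.inl ⟨ha', hb', hab, fun x hx h1 => ?_⟩, rfl⟩,
    ⟨c, d, Or.inr ⟨hc', hd', hcd, fun x hx h1 => ?_⟩, rfl⟩, ?_⟩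
  · by_contra h2; exact hA x hx h1 (by linarith)
  · by_contra h2; exact hB x hx h1 (by linarith)
  ext q
  rw [mem_cell_iff_coord hα]
  constructor
  · exact fun h => h.2
  · rintro ⟨⟨h1, h2⟩, h3, h4⟩
    refine ⟨⟨?_, ?_, ?_, ?_⟩, ⟨?_, ?_⟩, ?_, ?_⟩ <;> linarith

theorem IsCell.eq_of_overlap {α : ℝ} {A B : Set ℝ} {a b c d a' b' c' d' : ℝ}
    (h : IsCell α A B a b c d) (h' : IsCell α A B a' b' c' d')
    (ho : (a < b' ∧ a' < b) ∧ c < d' ∧ c' < d) : cell α a b c d = cell α a' b' c' d' := by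
  obtain ⟨rfl, rfl⟩ := h.gapU.eq_of_overlap h'.gapU ho.1.1 ho.1.2
  obtain ⟨rfl, rfl⟩ := h.gapV.eq_of_overlap h'.gapV ho.2.1 ho.2.2
  rfl

theorem IsCell.eq_of_cornerCell {α : ℝ} {A B : Set ℝ} {a b c d a' b' c' d' : ℝ}
    (h : IsCell α A B a b c d) (h' : IsCell α A B a' b' c' d') {i : Fin 3}
    (hi : CornerCell α a b c d i) (hi' : CornerCell α a' b' c' d' i) :
    cell α a b c d = cell α a' b' c' d' := by
  have h1 := h.gapU.lt
  have h2 := h.gapV.lt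
  have h3 := h'.gapU.lt
  have h4 := h'.gapV.lt
  refine h.eq_of_overlap h' ?_
  fin_cases i <;> obtain ⟨h5, h6, h7⟩ := hi <;> obtain ⟨h5', h6', h7'⟩ := hi' <;>
    refine ⟨⟨?_, ?_⟩, ?_, ?_⟩ <;> linarith

/-- The wall and the parameter are determined by uniqueness of the exception, and two end cells at
the same point overlap. -/
theorem IsCell.eq_of_endCell {α : ℝ} (hα : 0 < α) {k k' : ℤ} (hk : Bounds k k')
    {a b c d a' b' c' d' : ℝ} (h : IsCell α (linesU α k) (linesV α k') a b c d)
    (h' : IsCell α (linesU α k) (linesV α k') a' b' c' d')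
    (he : ∃ w e, Wall.EndCell α (linesU α k) (linesV α k') a b c d e w)
    (he' : ∃ w e, Wall.EndCell α (linesU α k) (linesV α k') a' b' c' d' e w) :
    cell α a b c d = cell α a' b' c' d' := by
  obtain ⟨w, e, he⟩ := he
  obtain ⟨w', e', he'⟩ := he'
  obtain ⟨h1, h2, h3⟩ := he.exception
  obtain ⟨h1', h2', h3'⟩ := he'.exception
  obtain rfl := exception_wall_eq hα hk h1 h2 h1' h2' h3 h3'
  obtain rfl := exception_eq hα hk w h1.le h2.le h1'.le h2'.le h3 h3'
  exact h.eq_of_overlap h' (he.overlap he' h.gapU.lt h.gapV.lt h'.gapU.lt h'.gapV.lt)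

/-! ### Congruences between cells -/

/-- The reflection in the vertical axis. -/
noncomputable def reflX : Plane ≃ₗᵢ[ℝ] Plane :=
  LinearIsometryEquiv.piLpCongrRight 2
    ![LinearIsometryEquiv.neg ℝ, LinearIsometryEquiv.refl ℝ ℝ]

theorem reflX_apply_zero (p : Plane) : reflX p 0 = -p 0 := by simp [reflX]

theorem reflX_apply_one (p : Plane) : reflX p 1 = p 1 := by simp [reflX]

theorem coordU_reflX (α : ℝ) (p : Plane) : coordU α (reflX p) = coordV α p := by
  rw [coordU, coordV, reflX_apply_zero, reflX_apply_one]; ring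

theorem coordV_reflX (α : ℝ) (p : Plane) : coordV α (reflX p) = coordU α p := by
  rw [coordU, coordV, reflX_apply_zero, reflX_apply_one]; ring

/-- The point with given coordinates `coordU` and `coordV`. -/
noncomputable def ofCoord (α s t : ℝ) : Plane := !₂[(t - s) / (2 * α), (s + t) / 2]

theorem coordU_ofCoord {α : ℝ} (hα : 0 < α) (s t : ℝ) : coordU α (ofCoord α s t) = s := by
  simp only [coordU, ofCoord, PiLp.toLp_apply, Matrix.cons_val_zero, Matrix.cons_val_one]
  field_simp; ring

theorem coordV_ofCoord {α : ℝ} (hα : 0 < α) (s t : ℝ) : coordV α (ofCoord α s t) = t := by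
  simp only [coordV, ofCoord, PiLp.toLp_apply, Matrix.cons_val_zero, Matrix.cons_val_one]
  field_simp; ring

theorem coordU_add (α : ℝ) (p q : Plane) : coordU α (p + q) = coordU α p + coordU α q := by
  simp only [coordU, PiLp.add_apply]; ring

theorem coordV_add (α : ℝ) (p q : Plane) : coordV α (p + q) = coordV α p + coordV α q := by
  simp only [coordV, PiLp.add_apply]; ring

theorem coordU_neg (α : ℝ) (p : Plane) : coordU α (-p) = -coordU α p := by
  simp only [coordU, PiLp.neg_apply]; ring

theorem coordV_neg (α : ℝ) (p : Plane) : coordV α (-p) = -coordV α p := by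
  simp only [coordV, PiLp.neg_apply]; ring

theorem SameShape.closure_of_mem_iff {A B : Set Plane} (e : Plane ≃ᵢ Plane)
    (h : ∀ p, p ∈ A ↔ e p ∈ B) : SameShape (closure A) (closure B) := by
  refine ⟨e, ?_⟩
  have : A = e ⁻¹' B := Set.ext h
  have h2 : e '' closure A = closure (e '' A) := e.toHomeomorph.image_closure A
  rw [h2, this, Set.image_preimage_eq B e.surjective]

theorem SameShape.symm {P Q : Set Plane} (h : SameShape P Q) : SameShape Q P :=
  shapeSetoid.symm h

theorem sameShape_box {α : ℝ} (hα : 0 < α) (a b c d : ℝ) :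
    SameShape (closure (box α a b c d)) (closure (box α 0 (b - a) 0 (d - c))) := by
  refine SameShape.closure_of_mem_iff (IsometryEquiv.addRight (ofCoord α (-a) (-c))) fun p => ?_
  simp only [box, Set.mem_ofPred_eq, IsometryEquiv.addRight_apply, coordU_add, coordV_add,
    coordU_ofCoord hα, coordV_ofCoord hα]
  constructor <;> rintro ⟨⟨h1, h2⟩, h3, h4⟩ <;> refine ⟨⟨?_, ?_⟩, ?_, ?_⟩ <;> linarith

theorem sameShape_box_swap (α g h : ℝ) :
    SameShape (closure (box α 0 g 0 h)) (closure (box α 0 h 0 g)) := by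
  refine SameShape.closure_of_mem_iff reflX.toIsometryEquiv fun p => ?_
  simp only [box, Set.mem_ofPred_eq, LinearIsometryEquiv.coe_toIsometryEquiv, coordU_reflX,
    coordV_reflX]
  exact and_comm

/-- A vertical or a horizontal wall, represented by the left or the bottom one. -/
def Wall.dir : Wall → Wall
  | left => left
  | top => bottom
  | bottom => bottom
  | right => left

/-- Triangles on the left and bottom walls are merely translated; those on the right and top walls
are first turned by a half-turn. -/
theorem sameShape_wallTri {α : ℝ} (hα : 0 < α) (s t : ℝ) (w : Wall) :
    SameShape (closure (wallTri α s t w)) (closure (wallTri α 0 (t - s) w.dir)) := by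
  cases w
  · refine SameShape.closure_of_mem_iff (IsometryEquiv.addRight (ofCoord α (-s) (-s))) fun p => ?_
    simp only [Wall.dir, wallTri, Set.mem_ofPred_eq, IsometryEquiv.addRight_apply, coordU_add,
      coordV_add, coordU_ofCoord hα, coordV_ofCoord hα]
    constructor <;> rintro ⟨h1, h2, h3⟩ <;> refine ⟨?_, ?_, ?_⟩ <;> linarith
  · refine SameShape.closure_of_mem_iff ((LinearIsometryEquiv.neg ℝ).toIsometryEquiv.trans
      (IsometryEquiv.addRight (ofCoord α s (1 - s)))) fun p => ?_
    simp only [Wall.dir, wallTri, Set.mem_ofPred_eq, IsometryEquiv.addRight_apply, coordU_add,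
      coordV_add, coordU_ofCoord hα, coordV_ofCoord hα, IsometryEquiv.trans_apply,
      LinearIsometryEquiv.coe_toIsometryEquiv, LinearIsometryEquiv.coe_neg, coordU_neg, coordV_neg]
    constructor <;> rintro ⟨h1, h2, h3⟩ <;> refine ⟨?_, ?_, ?_⟩ <;> linarith
  · refine SameShape.closure_of_mem_iff (IsometryEquiv.addRight (ofCoord α s (-s))) fun p => ?_
    simp only [Wall.dir, wallTri, Set.mem_ofPred_eq, IsometryEquiv.addRight_apply, coordU_add,
      coordV_add, coordU_ofCoord hα, coordV_ofCoord hα]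
    constructor <;> rintro ⟨h1, h2, h3⟩ <;> refine ⟨?_, ?_, ?_⟩ <;> linarith
  · refine SameShape.closure_of_mem_iff ((LinearIsometryEquiv.neg ℝ).toIsometryEquiv.trans
      (IsometryEquiv.addRight (ofCoord α (-s) (α - s)))) fun p => ?_
    simp only [Wall.dir, wallTri, Set.mem_ofPred_eq, IsometryEquiv.addRight_apply, coordU_add,
      coordV_add, coordU_ofCoord hα, coordV_ofCoord hα, IsometryEquiv.trans_apply,
      LinearIsometryEquiv.coe_toIsometryEquiv, LinearIsometryEquiv.coe_neg, coordU_neg, coordV_neg]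
    constructor <;> rintro ⟨h1, h2, h3⟩ <;> refine ⟨?_, ?_, ?_⟩ <;> linarith

/-! ### Areas -/

/-- The linear map `p ↦ (u, v)` has determinant `-2α`, which accounts for the factor `1 / (2α)` in
all areas. -/
theorem volume_preimage_coord {α : ℝ} (hα : 0 < α) {S : Set (ℝ × ℝ)} (hS : MeasurableSet S) :
    volume {p : Plane | (coordU α p, coordV α p) ∈ S} =
      ENNReal.ofReal (1 / (2 * α)) * volume S := by
  let N : Matrix (Fin 2) (Fin 2) ℝ := !![-α, 1; α, 1]
  have hdet : N.det = -(2 * α) := by simp [N, Matrix.det_fin_two]; ring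
  have hN : N.det ≠ 0 := by rw [hdet]; linarith
  have h1 := (volume_preserving_finTwoArrow ℝ).measure_preimage hS.nullMeasurableSet
  have hS' : MeasurableSet (MeasurableEquiv.finTwoArrow ⁻¹' S : Set (Fin 2 → ℝ)) :=
    MeasurableEquiv.finTwoArrow.measurable hS
  have h2 := congrArg (fun μ => μ (MeasurableEquiv.finTwoArrow ⁻¹' S : Set (Fin 2 → ℝ)))
    (Real.map_matrix_volume_pi_eq_smul_volume_pi hN)
  have hm : Measurable (Matrix.toLin' N) := (LinearMap.continuous_of_finiteDimensional _).measurable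
  simp only [Measure.smul_apply, smul_eq_mul] at h2
  rw [Measure.map_apply hm hS', h1, hdet] at h2
  have h3 := (PiLp.volume_preserving_ofLp (Fin 2)).measure_preimage
    (hm hS').nullMeasurableSet
  rw [h2] at h3
  have hab : |(-(2 * α))⁻¹| = 1 / (2 * α) := by
    rw [abs_inv, abs_neg, abs_of_pos (by linarith), one_div]
  rw [hab] at h3
  rw [← h3]
  congr 1
  ext p
  simp only [Set.mem_ofPred_eq, Set.mem_preimage]
  have : MeasurableEquiv.finTwoArrow (Matrix.toLin' N (WithLp.ofLp p)) =
      (coordU α p, coordV α p) := by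
    simp [MeasurableEquiv.finTwoArrow, N, dotProduct, Fin.sum_univ_two, coordU,
      coordV]
    constructor <;> ring
  rw [this]

theorem volume_between {α : ℝ} (hα : 0 < α) {a b : ℝ} (hab : a ≤ b) (f₀ f₁ g₀ g₁ : ℝ)
    (hfg : ∀ s, a < s → s < b → f₀ + f₁ * s ≤ g₀ + g₁ * s) :
    volume {p : Plane | (a < coordU α p ∧ coordU α p < b) ∧
      f₀ + f₁ * coordU α p < coordV α p ∧ coordV α p < g₀ + g₁ * coordU α p} =
      ENNReal.ofReal (((g₀ - f₀) * (b - a) + (g₁ - f₁) * (b ^ 2 - a ^ 2) / 2) / (2 * α)) := by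
  have hf : Continuous fun s : ℝ => f₀ + f₁ * s := by fun_prop
  have hg : Continuous fun s : ℝ => g₀ + g₁ * s := by fun_prop
  have h1 := volume_regionBetween_eq_integral (μ := (volume : Measure ℝ)) (s := Set.Ioo a b)
    ((hf.integrableOn_Icc (a := a) (b := b)).mono_set Set.Ioo_subset_Icc_self)
    ((hg.integrableOn_Icc (a := a) (b := b)).mono_set Set.Ioo_subset_Icc_self)
    measurableSet_Ioo (fun x hx => hfg x hx.1 hx.2)
  have h2 : ∫ y in Set.Ioo a b, ((fun s : ℝ => g₀ + g₁ * s) - fun s : ℝ => f₀ + f₁ * s) y =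
      (g₀ - f₀) * (b - a) + (g₁ - f₁) * (b ^ 2 - a ^ 2) / 2 := by
    rw [← integral_Ioc_eq_integral_Ioo, ← intervalIntegral.integral_of_le hab]
    have : ((fun s : ℝ => g₀ + g₁ * s) - fun s : ℝ => f₀ + f₁ * s) =
        fun s : ℝ => (g₀ - f₀) + (g₁ - f₁) * s := by
      funext s; simp only [Pi.sub_apply]; ring
    rw [this, intervalIntegral.integral_add (by simp) (by
      exact (by fun_prop : Continuous fun s : ℝ => (g₁ - f₁) * s).intervalIntegrable _ _),
      intervalIntegral.integral_const_mul, integral_id, intervalIntegral.integral_const,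
      smul_eq_mul]
    ring
  have h3 := volume_preimage_coord hα (measurableSet_regionBetween hf.measurable hg.measurable
    (measurableSet_Ioo (a := a) (b := b)))
  rw [Measure.volume_eq_prod, h1, h2, ← ENNReal.ofReal_mul (by positivity)] at h3
  refine Eq.trans ?_ (h3.trans ?_)
  · rfl
  · congr 1
    ring

theorem volume_between_swap {α : ℝ} (hα : 0 < α) {a b : ℝ} (hab : a ≤ b) (f₀ f₁ g₀ g₁ : ℝ)
    (hfg : ∀ s, a < s → s < b → f₀ + f₁ * s ≤ g₀ + g₁ * s) :
    volume {p : Plane | (a < coordV α p ∧ coordV α p < b) ∧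
      f₀ + f₁ * coordV α p < coordU α p ∧ coordU α p < g₀ + g₁ * coordV α p} =
      ENNReal.ofReal (((g₀ - f₀) * (b - a) + (g₁ - f₁) * (b ^ 2 - a ^ 2) / 2) / (2 * α)) := by
  rw [← volume_between hα hab f₀ f₁ g₀ g₁ hfg,
    ← reflX.measurePreserving.measure_preimage_emb
      reflX.toIsometryEquiv.toHomeomorph.measurableEmbedding]
  simp only [Set.preimage_ofPred_eq, coordU_reflX, coordV_reflX]

theorem volume_box {α : ℝ} (hα : 0 < α) {a b c d : ℝ} (hab : a ≤ b) (hcd : c ≤ d) :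
    volume (box α a b c d) = ENNReal.ofReal ((b - a) * (d - c) / (2 * α)) := by
  have := volume_between hα hab c 0 d 0 (fun s _ _ => by linarith)
  simp only [zero_mul, add_zero] at this
  rw [box, this]
  congr 1
  ring

theorem volume_wallTri {α : ℝ} (hα : 0 < α) {s t : ℝ} (hst : s ≤ t) (w : Wall) :
    volume (wallTri α s t w) = ENNReal.ofReal ((t - s) ^ 2 / (4 * α)) := by
  have key : ∀ {a b f₀ f₁ g₀ g₁ : ℝ}, a ≤ b →
      (∀ s, a < s → s < b → f₀ + f₁ * s ≤ g₀ + g₁ * s) →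
      (g₀ - f₀) * (b - a) + (g₁ - f₁) * (b ^ 2 - a ^ 2) / 2 = (t - s) ^ 2 / 2 →
      (∀ p, p ∈ wallTri α s t w ↔ (a < coordU α p ∧ coordU α p < b) ∧
        f₀ + f₁ * coordU α p < coordV α p ∧ coordV α p < g₀ + g₁ * coordU α p) →
      volume (wallTri α s t w) = ENNReal.ofReal ((t - s) ^ 2 / (4 * α)) := by
    intro a b f₀ f₁ g₀ g₁ hab hfg he hmem
    rw [Set.ext hmem]
    refine (volume_between hα hab f₀ f₁ g₀ g₁ hfg).trans ?_
    rw [he]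
    congr 1
    field_simp; ring
  cases w
  · refine key (a := s) (b := t) (f₀ := 0) (f₁ := 1) (g₀ := t) (g₁ := 0) hst
      (fun _ _ _ => by linarith) (by ring) fun p => ?_
    constructor
    · rintro ⟨h1, h2, h3⟩; refine ⟨⟨?_, ?_⟩, ?_, ?_⟩ <;> linarith
    · rintro ⟨⟨h1, h2⟩, h3, h4⟩; refine ⟨?_, ?_, ?_⟩ <;> linarith
  · refine key (a := s) (b := t) (f₀ := 1 - t) (f₁ := 0) (g₀ := 1) (g₁ := -1) hst
      (fun _ _ _ => by linarith) (by ring) fun p => ?_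
    constructor
    · rintro ⟨h1, h2, h3⟩; refine ⟨⟨?_, ?_⟩, ?_, ?_⟩ <;> linarith
    · rintro ⟨⟨h1, h2⟩, h3, h4⟩; refine ⟨?_, ?_, ?_⟩ <;> linarith
  · refine key (a := -t) (b := -s) (f₀ := 0) (f₁ := -1) (g₀ := t) (g₁ := 0) (by linarith)
      (fun _ _ _ => by linarith) (by ring) fun p => ?_
    constructor
    · rintro ⟨h1, h2, h3⟩; refine ⟨⟨?_, ?_⟩, ?_, ?_⟩ <;> linarith
    · rintro ⟨⟨h1, h2⟩, h3, h4⟩; refine ⟨?_, ?_, ?_⟩ <;> linarith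
  · refine key (a := -t) (b := -s) (f₀ := α - t) (f₁ := 0) (g₀ := α) (g₁ := 1) (by linarith)
      (fun _ _ _ => by linarith) (by ring) fun p => ?_
    constructor
    · rintro ⟨h1, h2, h3⟩; refine ⟨⟨?_, ?_⟩, ?_, ?_⟩ <;> linarith
    · rintro ⟨⟨h1, h2⟩, h3, h4⟩; refine ⟨?_, ?_, ?_⟩ <;> linarith

theorem volume_closure_cell (α a b c d : ℝ) :
    volume (closure (cell α a b c d)) = volume (cell α a b c d) :=
  measure_closure_of_null_frontier ((convex_cell α a b c d).addHaar_frontier volume)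

/-! ### Counting areas and shapes -/

theorem encard_image_le_of_exceptions {ι β : Type*} {n m : ℕ} {S : Set ι} {f : ι → β}
    (φ : Fin n → β) (T : Fin m → Set ι) (hT : ∀ i, (T i).Subsingleton)
    (h : ∀ P ∈ S, f P ∈ Set.range φ ∨ ∃ i, P ∈ T i) : (f '' S).encard ≤ n + m := by
  classical
  rcases S.eq_empty_or_nonempty with rfl | ⟨P₀, -⟩
  · simp
  -- An empty exceptional set gets the dummy element `P₀`, which can only enlarge the range of `ψ`.
  let ψ : Fin n ⊕ Fin m → β :=
    Sum.elim φ fun i => f (if h : (T i).Nonempty then h.some else P₀)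
  have hsub : f '' S ⊆ ψ '' Set.univ := by
    rintro _ ⟨P, hP, rfl⟩
    rcases h P hP with ⟨i, hi⟩ | ⟨i, hi⟩
    · exact ⟨Sum.inl i, Set.mem_univ _, hi⟩
    · refine ⟨Sum.inr i, Set.mem_univ _, ?_⟩
      have hne : (T i).Nonempty := ⟨P, hi⟩
      simp only [ψ, Sum.elim_inr, dif_pos hne]
      rw [hT i hne.some_mem hi]
  refine (Set.encard_le_encard hsub).trans ((Set.encard_image_le _ _).trans ?_)
  rw [Set.encard_univ, ENat.card_eq_coe_fintype_card]
  simp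

/-- The pieces that are neither parallelograms between consecutive lines nor halves of such
rhombi: those at three corners, and one at the end of the orbit. -/
def exceptionalPieces (α : ℝ) (k k' : ℤ) (i : Fin 4) : Set (Set Plane) :=
  {P | ∃ a b c d, IsCell α (linesU α k) (linesV α k') a b c d ∧ P = closure (cell α a b c d) ∧
    (Fin.snoc (CornerCell α a b c d)
      (∃ w e, Wall.EndCell α (linesU α k) (linesV α k') a b c d e w) : Fin 4 → Prop) i}

theorem exceptionalPieces_subsingleton {α : ℝ} (hα : 0 < α) {k k' : ℤ} (hk : Bounds k k')
    (i : Fin 4) : (exceptionalPieces α k k' i).Subsingleton := by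
  rintro P ⟨a, b, c, d, h, rfl, hi⟩ Q ⟨a', b', c', d', h', rfl, hi'⟩
  congr 1
  induction i using Fin.lastCases with
  | last =>
    rw [Fin.snoc_last] at hi hi'
    exact h.eq_of_endCell hα hk h' hi hi'
  | cast j =>
    rw [Fin.snoc_castSucc] at hi hi'
    exact h.eq_of_cornerCell h' hi hi'

theorem cells_cases {α : ℝ} (hα : 0 < α) {k k' : ℤ} (hk : Bounds k k') {P : Set Plane}
    (hP : P ∈ cells α (linesU α k) (linesV α k')) :
    (∃ a b c d, a < b ∧ c < d ∧ IsLen α k k' (b - a) ∧ IsLen α k k' (d - c) ∧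
      P = closure (box α a b c d) ∧ volume P = volume (box α a b c d)) ∨
    (∃ w s t, s < t ∧ IsLen α k k' (t - s) ∧
      P = closure (wallTri α s t w) ∧ volume P = volume (wallTri α s t w)) ∨
    ∃ i, P ∈ exceptionalPieces α k k' i := by
  obtain ⟨a, b, c, d, h, rfl⟩ := hP
  rcases cell_cases hα hk h with ⟨h1, h2, h3⟩ | ⟨w, s, t, h1, h2⟩ | ⟨i, hi⟩ | he
  · exact Or.inl ⟨a, b, c, d, h.gapU.lt, h.gapV.lt, h1, h2, by rw [h3], by
      rw [volume_closure_cell, h3]⟩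
  · refine Or.inr (Or.inl ⟨w, s, t, ?_, h1, by rw [h2], by rw [volume_closure_cell, h2]⟩)
    obtain ⟨x, y, hxy, he⟩ := h1
    have : x < y := by rcases hxy with h | h <;> exact h.2.2.1
    linarith
  · exact Or.inr (Or.inr ⟨i.castSucc, a, b, c, d, h, rfl, by rwa [Fin.snoc_castSucc]⟩)
  · exact Or.inr (Or.inr ⟨Fin.last 3, a, b, c, d, h, rfl, by rwa [Fin.snoc_last]⟩)

/-- Six products of two gap lengths, three half-rhombi, whose area does not depend on the direction
of the wall, and four exceptional pieces. -/
theorem encard_volume_cells_le {α : ℝ} (hα : 0 < α) {k k' : ℤ} (hk : Bounds k k') :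
    ((fun P : Set Plane => volume P) '' cells α (linesU α k) (linesV α k')).encard ≤ 13 := by
  obtain ⟨r, l, hr, hl, hG⟩ := three_gap_lines hα hk
  have hlen : ∀ g, IsLen α k k' g → g = r ∨ g = l ∨ g = r + l := by
    rintro g ⟨x, y, h, rfl⟩
    exact hG x y h
  let f : ℝ → ENNReal := fun x => ENNReal.ofReal (x / (4 * α))
  refine encard_image_le_of_exceptions (n := 9) (m := 4)
    ![f (2 * (r * r)), f (2 * (r * l)), f (2 * (r * (r + l))), f (2 * (l * l)),
      f (2 * (l * (r + l))), f (2 * ((r + l) * (r + l))), f (r ^ 2), f (l ^ 2), f ((r + l) ^ 2)]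
    _ (exceptionalPieces_subsingleton hα hk) fun P hP => ?_
  rcases cells_cases hα hk hP with ⟨a, b, c, d, hab, hcd, h1, h2, -, h3⟩ | ⟨w, s, t, hst, h1, -, h3⟩ | h
  · left
    rw [h3, volume_box hα hab.le hcd.le,
      show (b - a) * (d - c) / (2 * α) = 2 * ((b - a) * (d - c)) / (4 * α) by field_simp; ring]
    rcases hlen _ h1 with h1 | h1 | h1 <;> rcases hlen _ h2 with h2 | h2 | h2 <;> rw [h1, h2]
    · exact ⟨0, rfl⟩
    · exact ⟨1, rfl⟩
    · exact ⟨2, rfl⟩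
    · exact ⟨1, by rw [mul_comm l r]; rfl⟩
    · exact ⟨3, rfl⟩
    · exact ⟨4, rfl⟩
    · exact ⟨2, by rw [mul_comm (r + l) r]; rfl⟩
    · exact ⟨4, by rw [mul_comm (r + l) l]; rfl⟩
    · exact ⟨5, rfl⟩
  · left
    rw [h3, volume_wallTri hα hst.le]
    rcases hlen _ h1 with h1 | h1 | h1 <;> rw [h1]
    · exact ⟨6, rfl⟩
    · exact ⟨7, rfl⟩
    · exact ⟨8, rfl⟩
  · exact Or.inr h

/-- The parallelograms again count six, since a reflection exchanges their two gap lengths; the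
half-rhombi count twice three, by direction of the wall; four pieces are exceptional. -/
theorem encard_shape_cells_le {α : ℝ} (hα : 0 < α) {k k' : ℤ} (hk : Bounds k k') :
    (Quotient.mk shapeSetoid '' cells α (linesU α k) (linesV α k')).encard ≤ 16 := by
  obtain ⟨r, l, hr, hl, hG⟩ := three_gap_lines hα hk
  have hlen : ∀ g, IsLen α k k' g → g = r ∨ g = l ∨ g = r + l := by
    rintro g ⟨x, y, h, rfl⟩
    exact hG x y h
  let bx : ℝ → ℝ → Quotient shapeSetoid := fun g h => Quotient.mk _ (closure (box α 0 g 0 h))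
  let tr : ℝ → Wall → Quotient shapeSetoid := fun g w => Quotient.mk _ (closure (wallTri α 0 g w))
  have hswap : ∀ g h, bx g h = bx h g := fun g h => Quotient.sound (sameShape_box_swap α g h)
  refine encard_image_le_of_exceptions (n := 12) (m := 4)
    ![bx r r, bx r l, bx r (r + l), bx l l, bx l (r + l), bx (r + l) (r + l),
      tr r .left, tr l .left, tr (r + l) .left, tr r .bottom, tr l .bottom, tr (r + l) .bottom]
    _ (exceptionalPieces_subsingleton hα hk) fun P hP => ?_
  rcases cells_cases hα hk hP with ⟨a, b, c, d, hab, hcd, h1, h2, rfl, -⟩ | ⟨w, s, t, hst, h1, rfl, -⟩ | h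
  · left
    rw [show Quotient.mk shapeSetoid (closure (box α a b c d)) = bx (b - a) (d - c) from
      Quotient.sound (sameShape_box hα a b c d)]
    rcases hlen _ h1 with h1 | h1 | h1 <;> rcases hlen _ h2 with h2 | h2 | h2 <;> rw [h1, h2]
    · exact ⟨0, rfl⟩
    · exact ⟨1, rfl⟩
    · exact ⟨2, rfl⟩
    · exact ⟨1, hswap r l⟩
    · exact ⟨3, rfl⟩
    · exact ⟨4, rfl⟩
    · exact ⟨2, hswap r (r + l)⟩
    · exact ⟨4, hswap l (r + l)⟩
    · exact ⟨5, rfl⟩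
  · left
    rw [show Quotient.mk shapeSetoid (closure (wallTri α s t w)) = tr (t - s) w.dir from
      Quotient.sound (sameShape_wallTri hα s t w)]
    rcases hlen _ h1 with h1 | h1 | h1 <;> rw [h1] <;> cases w
    · exact ⟨6, rfl⟩
    · exact ⟨9, rfl⟩
    · exact ⟨9, rfl⟩
    · exact ⟨6, rfl⟩
    · exact ⟨7, rfl⟩
    · exact ⟨10, rfl⟩
    · exact ⟨10, rfl⟩
    · exact ⟨7, rfl⟩
    · exact ⟨8, rfl⟩
    · exact ⟨11, rfl⟩
    · exact ⟨11, rfl⟩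
    · exact ⟨8, rfl⟩
  · exact Or.inr h

theorem partition_and_bounds {α M : ℝ} (hα : 0 < α) (hM : 0 < M)
    (h : orbitPoint α M ∈ table \ openTable) :
    IsPolygonPartition (pieces α M) table ∧ numAreas α M ≤ 13 ∧ numShapes α M ≤ 16 := by
  unfold numAreas numShapes
  rw [pieces_eq_cells hα h]
  exact ⟨isPolygonPartition_cells hα (rotPts_finite hα _ _ _ _) (rotPts_finite hα _ _ _ _),
    encard_volume_cells_le hα (bounds_lastBox hα hM),
    encard_shape_cells_le hα (bounds_lastBox hα hM)⟩

theorem orbitPoint_mem_table (α t : ℝ) : orbitPoint α t ∈ table := by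
  have h0 := distNearestInt_mem t
  have h1 := distNearestInt_mem (α * t)
  exact mem_table_iff.2 (by simpa [orbitPoint] using ⟨h0.1, by simpa using h0.2, h1.1, by simpa using h1.2⟩)

/-! ### The extremal example: orbit, lines and gaps -/

/-- The slope of the extremal example. -/
noncomputable abbrev slope : ℝ := Real.sqrt 10 / 7

theorem slope_sq : slope ^ 2 = 10 / 49 := by
  rw [slope, div_pow, Real.sq_sqrt (by norm_num)]; norm_num

theorem slope_pos : 0 < slope := by positivity

theorem slope_gt : 0.4517539 < slope := by
  by_contra h; push Not at h; nlinarith [slope_sq, slope_pos]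

theorem slope_lt : slope < 0.451754 := by
  by_contra h; push Not at h; nlinarith [slope_sq, slope_pos]

theorem floor_mem_squares {t : ℝ} (h0 : 0 ≤ t) (h8 : t < 8) : unitSquareAt slope t ∈
    ({(0, 0), (1, 0), (2, 0), (2, 1), (3, 1), (4, 1), (4, 2), (5, 2), (6, 2), (6, 3), (7, 3)} :
      Finset (ℤ × ℤ)) := by
  have h1 := slope_gt
  have h2 := slope_lt
  unfold unitSquareAt
  have hk0 : 0 ≤ ⌊t⌋ := Int.floor_nonneg.2 h0
  have hk8 : ⌊t⌋ < 8 := by rw [Int.floor_lt]; exact_mod_cast h8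
  have ha := Int.floor_le t
  have hb := Int.lt_floor_add_one t
  have hc := Int.floor_le (slope * t)
  have hd := Int.lt_floor_add_one (slope * t)
  generalize ⌊t⌋ = k at *
  generalize ⌊slope * t⌋ = m at *
  -- The bounds `0.45175 < α < 0.45176` are scaled to integers, so that each column leaves a finite
  -- integer problem.
  have e1 : (m : ℝ) * 100000 < 45176 * (k + 1) := by nlinarith
  have hk0' : (0 : ℝ) ≤ k := by exact_mod_cast hk0
  have e2 : 45175 * (k : ℝ) < (m + 1) * 100000 := by nlinarith
  have e1' : m * 100000 < 45176 * (k + 1) := by exact_mod_cast e1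
  have e2' : 45175 * k < (m + 1) * 100000 := by exact_mod_cast e2
  simp only [Finset.mem_insert, Finset.mem_singleton, Prod.mk.injEq]
  interval_cases k <;> simp <;> omega

theorem completesSquares_slope : CompletesSquares slope 11 8 := by
  have h1 := slope_gt
  have h2 := slope_lt
  constructor
  · have himg : unitSquareAt slope '' Set.Ico 0 8 =
        (({(0, 0), (1, 0), (2, 0), (2, 1), (3, 1), (4, 1), (4, 2), (5, 2), (6, 2), (6, 3), (7, 3)} :
          Finset (ℤ × ℤ)) : Set (ℤ × ℤ)) := by
      apply Set.Subset.antisymm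
      · rintro _ ⟨t, ⟨h0, h8⟩, rfl⟩
        exact floor_mem_squares h0 h8
      · have key : ∀ (t : ℝ) (k m : ℤ), 0 ≤ t → t < 8 → k ≤ t → t < k + 1 → m ≤ slope * t →
            slope * t < m + 1 → (k, m) ∈ unitSquareAt slope '' Set.Ico 0 8 := by
          intro t k m h0 h8 h1 h2 h3 h4
          exact ⟨t, ⟨h0, h8⟩, Prod.ext (Int.floor_eq_iff.2 ⟨h1, h2⟩) (Int.floor_eq_iff.2 ⟨h3, h4⟩)⟩
        simp only [Finset.coe_insert, Finset.coe_singleton, Set.insert_subset_iff,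
          Set.singleton_subset_iff]
        refine ⟨key 0 _ _ ?_ ?_ ?_ ?_ ?_ ?_, key 1 _ _ ?_ ?_ ?_ ?_ ?_ ?_,
          key 2 _ _ ?_ ?_ ?_ ?_ ?_ ?_, key 2.5 _ _ ?_ ?_ ?_ ?_ ?_ ?_, key 3 _ _ ?_ ?_ ?_ ?_ ?_ ?_,
          key 4 _ _ ?_ ?_ ?_ ?_ ?_ ?_, key 4.5 _ _ ?_ ?_ ?_ ?_ ?_ ?_, key 5 _ _ ?_ ?_ ?_ ?_ ?_ ?_,
          key 6 _ _ ?_ ?_ ?_ ?_ ?_ ?_, key 6.8 _ _ ?_ ?_ ?_ ?_ ?_ ?_,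
          key 7 _ _ ?_ ?_ ?_ ?_ ?_ ?_⟩ <;> push_cast <;> linarith
    rw [himg, Set.encard_coe_eq_coe_finsetCard]
    rfl
  · rintro ⟨t, ⟨h0, h8⟩, ht⟩
    have h3 : ⌊t⌋ = ⌊(8 : ℝ)⌋ := congrArg Prod.fst ht
    have h4 : ⌊t⌋ < 8 := by rw [Int.floor_lt]; exact_mod_cast h8
    rw [h3] at h4
    norm_num at h4

theorem orbitPoint_slope : orbitPoint slope 8 ∈ table \ openTable := by
  refine ⟨orbitPoint_mem_table _ _, fun h => ?_⟩
  have h0 := (mem_openTable_iff.1 h).1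
  have : distNearestInt 8 = 0 := by
    unfold distNearestInt
    rw [show round (8 : ℝ) = 8 from round_ofNat 8]; norm_num
  simp [orbitPoint, this] at h0

theorem lastBox_slope : lastBox slope 8 = 22 := by
  have h1 := slope_gt
  have h2 := slope_lt
  unfold lastBox
  have e1 : ⌈2 * (8 : ℝ)⌉ = 16 := by norm_num
  have e2 : ⌈2 * (slope * 8)⌉ = 8 := by
    rw [Int.ceil_eq_iff]; constructor <;> push_cast <;> linarith
  rw [e1, e2]; norm_num

/-- With `p = j - q` one has `p(1 + α) = x + j`, which confines `p` to `-8..8`. The last clause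
permits replacing `α` by a decimal in `pα`. -/
theorem exists_int_of_mem_lines {x : ℝ} {lo hi : ℤ} (hlo : -12 ≤ lo) (hhi : hi ≤ 11)
    (hx : x ∈ rotPts slope lo hi) (h1 : -0.23 ≤ x) (h2 : x ≤ 0.73) :
    ∃ p q : ℤ, x = p * slope - q ∧ lo ≤ p + q ∧ p + q ≤ hi ∧ -8 ≤ p ∧ p ≤ 8 ∧
      |(p : ℝ) * slope - 0.451754 * p| ≤ 0.00001 := by
  have s1 := slope_gt
  have s2 := slope_lt
  obtain ⟨j, q, h3, h4, rfl⟩ := hx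
  have h3' : (-12 : ℝ) ≤ j := by exact_mod_cast hlo.trans h3
  have h4' : (j : ℝ) ≤ 11 := by exact_mod_cast h4.trans hhi
  have hp1 : -8 ≤ j - q := by
    by_contra h
    have : j - q ≤ -9 := by omega
    have : (j : ℝ) - q ≤ -9 := by exact_mod_cast this
    nlinarith
  have hp2 : j - q ≤ 8 := by
    by_contra h
    have : 9 ≤ j - q := by omega
    have : (9 : ℝ) ≤ j - q := by exact_mod_cast this
    nlinarith
  have hp1' : (-8 : ℝ) ≤ ((j - q : ℤ) : ℝ) := by exact_mod_cast hp1
  have hp2' : ((j - q : ℤ) : ℝ) ≤ 8 := by exact_mod_cast hp2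
  refine ⟨j - q, q, by push_cast; ring, by omega, by omega, hp1, hp2, ?_⟩
  rw [abs_le]
  constructor <;> nlinarith

theorem mem_linesU_slope {x : ℝ} (hx : x ∈ linesU slope 11) (h1 : -(slope / 2) < x)
    (h2 : x < 1 / 2) : ∃ p q : ℤ, x = p * slope - q ∧
      (p, q) ∈ ({(4, 2), (-7, -3), (2, 1), (0, 0), (-2, -1), (7, 3), (-4, -2), (5, 2), (-6, -3),
        (3, 1), (-8, -4), (1, 0)} : Finset (ℤ × ℤ)) := by
  have s1 := slope_gt
  have s2 := slope_lt
  obtain ⟨p, q, rfl, h3, h4, h5, h6, h7⟩ :=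
    exists_int_of_mem_lines (by norm_num) (by norm_num) hx (by linarith) (by linarith)
  obtain ⟨h7, h8⟩ := abs_le.1 h7
  refine ⟨p, q, rfl, ?_⟩
  -- The constants are rounded-up multiples by `10^6` of `α / 2` and `1 / 2`, including the decimal
  -- error of at most `10`.
  have e1 : (q : ℝ) * 1000000 < 451754 * p + 226000 := by linarith
  have e2 : 451754 * (p : ℝ) - 500010 < q * 1000000 := by linarith
  have e1' : q * 1000000 < 451754 * p + 226000 := by exact_mod_cast e1
  have e2' : 451754 * p - 500010 < q * 1000000 := by exact_mod_cast e2
  simp only [Finset.mem_insert, Finset.mem_singleton, Prod.mk.injEq]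
  clear * - h3 h4 h5 h6 e1' e2'
  interval_cases p <;> simp <;> omega

theorem mem_linesV_slope {x : ℝ} (hx : x ∈ linesV slope 11) (h1 : 0 < x)
    (h2 : x < (1 + slope) / 2) : ∃ p q : ℤ, x = p * slope - q ∧
      (p, q) ∈ ({(-2, -1), (7, 3), (-4, -2), (5, 2), (-6, -3), (3, 1), (1, 0), (-1, -1), (8, 3),
        (-3, -2), (6, 2)} : Finset (ℤ × ℤ)) := by
  have s1 := slope_gt
  have s2 := slope_lt
  obtain ⟨p, q, rfl, h3, h4, h5, h6, h7⟩ :=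
    exists_int_of_mem_lines (by norm_num) (by norm_num) hx (by linarith) (by linarith)
  obtain ⟨h7, h8⟩ := abs_le.1 h7
  refine ⟨p, q, rfl, ?_⟩
  have hpq : ¬(p = 0 ∧ q = 0) := by rintro ⟨rfl, rfl⟩; simp at h1
  have e1 : (q : ℝ) * 1000000 < 451754 * p + 10 := by linarith
  have e2 : 451754 * (p : ℝ) - 725900 < q * 1000000 := by linarith
  have e1' : q * 1000000 < 451754 * p + 10 := by exact_mod_cast e1
  have e2' : 451754 * p - 725900 < q * 1000000 := by exact_mod_cast e2
  simp only [Finset.mem_insert, Finset.mem_singleton, Prod.mk.injEq]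
  clear * - h3 h4 h5 h6 e1' e2' hpq
  interval_cases p <;> simp at * <;> omega

theorem linesU_slope_mem {p q : ℤ} (h1 : -12 ≤ p + q) (h2 : p + q ≤ 11) :
    (p * slope - q : ℝ) ∈ linesU slope 11 :=
  ⟨p + q, q, by omega, by omega, by push_cast; ring⟩

theorem linesV_slope_mem {p q : ℤ} (h1 : -11 ≤ p + q) (h2 : p + q ≤ 11) :
    (p * slope - q : ℝ) ∈ linesV slope 11 :=
  ⟨p + q, q, by omega, by omega, by push_cast; ring⟩

theorem isGapU_slope {a b : ℝ} (ha : a ∈ linesU slope 11 ∨ a = -(slope / 2))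
    (hb : b ∈ linesU slope 11 ∨ b = 1 / 2) (h1 : -(slope / 2) ≤ a) (h2 : b ≤ 1 / 2) (h3 : a < b)
    (h : ∀ p q : ℤ, (p, q) ∈ ({(4, 2), (-7, -3), (2, 1), (0, 0), (-2, -1), (7, 3), (-4, -2),
      (5, 2), (-6, -3), (3, 1), (-8, -4), (1, 0)} : Finset (ℤ × ℤ)) →
        p * slope - q ≤ a ∨ b ≤ p * slope - q) :
    IsGap (linesU slope 11) (-(slope / 2)) (1 / 2) a b := by
  refine ⟨ha, hb, h1, h2, h3, fun x hx h4 h5 => ?_⟩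
  obtain ⟨p, q, rfl, hpq⟩ := mem_linesU_slope hx (by linarith) (by linarith)
  rcases h p q hpq with h | h <;> linarith

theorem isGapV_slope {c d : ℝ} (hc : c ∈ linesV slope 11 ∨ c = 0)
    (hd : d ∈ linesV slope 11 ∨ d = (1 + slope) / 2) (h1 : 0 ≤ c) (h2 : d ≤ (1 + slope) / 2)
    (h3 : c < d)
    (h : ∀ p q : ℤ, (p, q) ∈ ({(-2, -1), (7, 3), (-4, -2), (5, 2), (-6, -3), (3, 1), (1, 0),
      (-1, -1), (8, 3), (-3, -2), (6, 2)} : Finset (ℤ × ℤ)) →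
        p * slope - q ≤ c ∨ d ≤ p * slope - q) :
    IsGap (linesV slope 11) 0 ((1 + slope) / 2) c d := by
  refine ⟨hc, hd, h1, h2, h3, fun x hx h4 h5 => ?_⟩
  obtain ⟨p, q, rfl, hpq⟩ := mem_linesV_slope hx (by linarith) (by linarith)
  rcases h p q hpq with h | h <;> linarith

/-- The number `pα - q` for the slope `α` of the extremal example. -/
noncomputable abbrev lin (p q : ℤ) : ℝ := p * slope - q

/-- Some of the gaps between the lines of slope `α` in the extremal example. -/
theorem gapsU_slope :
    IsGap (linesU slope 11) (-(slope / 2)) (1 / 2) (-(slope / 2)) (lin (4) (2)) ∧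
    IsGap (linesU slope 11) (-(slope / 2)) (1 / 2) (lin (4) (2)) (lin (-7) (-3)) ∧
    IsGap (linesU slope 11) (-(slope / 2)) (1 / 2) (lin (-7) (-3)) (lin (2) (1)) ∧
    IsGap (linesU slope 11) (-(slope / 2)) (1 / 2) (lin (2) (1)) (lin (0) (0)) ∧
    IsGap (linesU slope 11) (-(slope / 2)) (1 / 2) (lin (0) (0)) (lin (-2) (-1)) ∧
    IsGap (linesU slope 11) (-(slope / 2)) (1 / 2) (lin (-2) (-1)) (lin (7) (3)) ∧
    IsGap (linesU slope 11) (-(slope / 2)) (1 / 2) (lin (7) (3)) (lin (-4) (-2)) ∧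
    IsGap (linesU slope 11) (-(slope / 2)) (1 / 2) (lin (5) (2)) (lin (-6) (-3)) ∧
    IsGap (linesU slope 11) (-(slope / 2)) (1 / 2) (lin (3) (1)) (lin (-8) (-4)) ∧
    IsGap (linesU slope 11) (-(slope / 2)) (1 / 2) (lin (1) (0)) (1 / 2) := by
  have s1 := slope_gt
  have s2 := slope_lt
  refine ⟨isGapU_slope (Or.inr rfl) (Or.inl (linesU_slope_mem (by norm_num) (by norm_num))) ?_ ?_ ?_ ?_,
    isGapU_slope (Or.inl (linesU_slope_mem (by norm_num) (by norm_num))) (Or.inl (linesU_slope_mem (by norm_num) (by norm_num))) ?_ ?_ ?_ ?_,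
    isGapU_slope (Or.inl (linesU_slope_mem (by norm_num) (by norm_num))) (Or.inl (linesU_slope_mem (by norm_num) (by norm_num))) ?_ ?_ ?_ ?_,
    isGapU_slope (Or.inl (linesU_slope_mem (by norm_num) (by norm_num))) (Or.inl (linesU_slope_mem (by norm_num) (by norm_num))) ?_ ?_ ?_ ?_,
    isGapU_slope (Or.inl (linesU_slope_mem (by norm_num) (by norm_num))) (Or.inl (linesU_slope_mem (by norm_num) (by norm_num))) ?_ ?_ ?_ ?_,
    isGapU_slope (Or.inl (linesU_slope_mem (by norm_num) (by norm_num))) (Or.inl (linesU_slope_mem (by norm_num) (by norm_num))) ?_ ?_ ?_ ?_,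
    isGapU_slope (Or.inl (linesU_slope_mem (by norm_num) (by norm_num))) (Or.inl (linesU_slope_mem (by norm_num) (by norm_num))) ?_ ?_ ?_ ?_,
    isGapU_slope (Or.inl (linesU_slope_mem (by norm_num) (by norm_num))) (Or.inl (linesU_slope_mem (by norm_num) (by norm_num))) ?_ ?_ ?_ ?_,
    isGapU_slope (Or.inl (linesU_slope_mem (by norm_num) (by norm_num))) (Or.inl (linesU_slope_mem (by norm_num) (by norm_num))) ?_ ?_ ?_ ?_,
    isGapU_slope (Or.inl (linesU_slope_mem (by norm_num) (by norm_num))) (Or.inr rfl) ?_ ?_ ?_ ?_⟩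
  all_goals first
    | exact le_rfl
    | (simp only [lin]; push_cast; linarith)
    | (intro p q hpq
       simp only [Finset.mem_insert, Finset.mem_singleton, Prod.mk.injEq] at hpq
       simp only [lin]
       rcases hpq with ⟨rfl, rfl⟩ | ⟨rfl, rfl⟩ | ⟨rfl, rfl⟩ | ⟨rfl, rfl⟩ | ⟨rfl, rfl⟩ | ⟨rfl, rfl⟩ | ⟨rfl, rfl⟩ | ⟨rfl, rfl⟩ | ⟨rfl, rfl⟩ | ⟨rfl, rfl⟩ | ⟨rfl, rfl⟩ | ⟨rfl, rfl⟩ <;> push_cast <;>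
         first | (left; linarith) | (right; linarith))

/-- Some of the gaps between the lines of slope `-α` in the extremal example. -/
theorem gapsV_slope :
    IsGap (linesV slope 11) 0 ((1 + slope) / 2) (lin (0) (0)) (lin (-2) (-1)) ∧
    IsGap (linesV slope 11) 0 ((1 + slope) / 2) (lin (-2) (-1)) (lin (7) (3)) ∧
    IsGap (linesV slope 11) 0 ((1 + slope) / 2) (lin (7) (3)) (lin (-4) (-2)) ∧
    IsGap (linesV slope 11) 0 ((1 + slope) / 2) (lin (-4) (-2)) (lin (5) (2)) ∧
    IsGap (linesV slope 11) 0 ((1 + slope) / 2) (lin (5) (2)) (lin (-6) (-3)) ∧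
    IsGap (linesV slope 11) 0 ((1 + slope) / 2) (lin (3) (1)) (lin (1) (0)) ∧
    IsGap (linesV slope 11) 0 ((1 + slope) / 2) (lin (1) (0)) (lin (-1) (-1)) ∧
    IsGap (linesV slope 11) 0 ((1 + slope) / 2) (lin (6) (2)) ((1 + slope) / 2) := by
  have s1 := slope_gt
  have s2 := slope_lt
  refine ⟨isGapV_slope (Or.inl (linesV_slope_mem (by norm_num) (by norm_num))) (Or.inl (linesV_slope_mem (by norm_num) (by norm_num))) ?_ ?_ ?_ ?_,
    isGapV_slope (Or.inl (linesV_slope_mem (by norm_num) (by norm_num))) (Or.inl (linesV_slope_mem (by norm_num) (by norm_num))) ?_ ?_ ?_ ?_,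
    isGapV_slope (Or.inl (linesV_slope_mem (by norm_num) (by norm_num))) (Or.inl (linesV_slope_mem (by norm_num) (by norm_num))) ?_ ?_ ?_ ?_,
    isGapV_slope (Or.inl (linesV_slope_mem (by norm_num) (by norm_num))) (Or.inl (linesV_slope_mem (by norm_num) (by norm_num))) ?_ ?_ ?_ ?_,
    isGapV_slope (Or.inl (linesV_slope_mem (by norm_num) (by norm_num))) (Or.inl (linesV_slope_mem (by norm_num) (by norm_num))) ?_ ?_ ?_ ?_,
    isGapV_slope (Or.inl (linesV_slope_mem (by norm_num) (by norm_num))) (Or.inl (linesV_slope_mem (by norm_num) (by norm_num))) ?_ ?_ ?_ ?_,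
    isGapV_slope (Or.inl (linesV_slope_mem (by norm_num) (by norm_num))) (Or.inl (linesV_slope_mem (by norm_num) (by norm_num))) ?_ ?_ ?_ ?_,
    isGapV_slope (Or.inl (linesV_slope_mem (by norm_num) (by norm_num))) (Or.inr rfl) ?_ ?_ ?_ ?_⟩
  all_goals first
    | exact le_rfl
    | (simp only [lin]; push_cast; linarith)
    | (intro p q hpq
       simp only [Finset.mem_insert, Finset.mem_singleton, Prod.mk.injEq] at hpq
       simp only [lin]
       rcases hpq with ⟨rfl, rfl⟩ | ⟨rfl, rfl⟩ | ⟨rfl, rfl⟩ | ⟨rfl, rfl⟩ | ⟨rfl, rfl⟩ | ⟨rfl, rfl⟩ | ⟨rfl, rfl⟩ | ⟨rfl, rfl⟩ | ⟨rfl, rfl⟩ | ⟨rfl, rfl⟩ | ⟨rfl, rfl⟩ <;> push_cast <;>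
         first | (left; linarith) | (right; linarith))

/-! ### Constructing pieces of given area -/

theorem isCell_of_coord {α : ℝ} (hα : 0 < α) {A B : Set ℝ} {a b c d s t : ℝ}
    (hU : IsGap A (-(α / 2)) (1 / 2) a b) (hV : IsGap B 0 ((1 + α) / 2) c d)
    (h : (s < t ∧ t - s < α ∧ 0 < s + t ∧ s + t < 1) ∧ (a < s ∧ s < b) ∧ (c < t ∧ t < d)) :
    IsCell α A B a b c d :=
  ⟨hU, hV, ofCoord α s t, by
    rw [mem_cell_iff_coord hα, coordU_ofCoord hα, coordV_ofCoord hα]; exact h⟩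

theorem exists_piece {α : ℝ} (hα : 0 < α) {A B : Set ℝ} {a b c d s t : ℝ}
    (hU : IsGap A (-(α / 2)) (1 / 2) a b) (hV : IsGap B 0 ((1 + α) / 2) c d)
    (h : (s < t ∧ t - s < α ∧ 0 < s + t ∧ s + t < 1) ∧ (a < s ∧ s < b) ∧ (c < t ∧ t < d))
    {R : Set Plane} {X : ENNReal} (hR : volume R = X) (hc : ∀ p, p ∈ cell α a b c d ↔ p ∈ R) :
    closure R ∈ cells α A B ∧ volume (closure R) = X := by
  have : cell α a b c d = R := Set.ext hc
  refine ⟨⟨a, b, c, d, isCell_of_coord hα hU hV h, by rw [this]⟩, ?_⟩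
  rw [← this, volume_closure_cell, this, hR]

theorem box_piece {α : ℝ} (hα : 0 < α) {A B : Set ℝ} {a b c d : ℝ}
    (hU : IsGap A (-(α / 2)) (1 / 2) a b) (hV : IsGap B 0 ((1 + α) / 2) c d)
    (h1 : b ≤ c) (h2 : b + d ≤ 1) (h3 : 0 ≤ a + c) (h4 : d - a ≤ α) :
    ∃ P ∈ cells α A B, volume P = ENNReal.ofReal ((b - a) * (d - c) / (2 * α)) := by
  have hab := hU.lt
  have hcd := hV.lt
  refine ⟨_, exists_piece hα hU hV (s := (a + b) / 2) (t := (c + d) / 2) ?_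
    (volume_box hα hab.le hcd.le) fun p => ?_⟩
  · refine ⟨⟨?_, ?_, ?_, ?_⟩, ⟨?_, ?_⟩, ?_, ?_⟩ <;> linarith
  · rw [mem_cell_iff_coord hα]
    constructor
    · exact fun h => h.2
    · rintro ⟨⟨h1, h2⟩, h3, h4⟩
      refine ⟨⟨?_, ?_, ?_, ?_⟩, ⟨?_, ?_⟩, ?_, ?_⟩ <;> linarith

theorem leftTri_piece {α : ℝ} (hα : 0 < α) {A B : Set ℝ} {s t : ℝ}
    (hU : IsGap A (-(α / 2)) (1 / 2) s t) (hV : IsGap B 0 ((1 + α) / 2) s t)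
    (h1 : 0 ≤ s) (h2 : t ≤ 1 / 2) (h3 : t - s ≤ α) :
    closure (wallTri α s t .left) ∈ cells α A B ∧
      volume (closure (wallTri α s t .left)) = ENNReal.ofReal ((t - s) ^ 2 / (4 * α)) := by
  have hst := hU.lt
  refine exists_piece hα hU hV (s := (2 * s + t) / 3) (t := (s + 2 * t) / 3) ?_
    (volume_wallTri hα hst.le _) fun p => ?_
  · refine ⟨⟨?_, ?_, ?_, ?_⟩, ⟨?_, ?_⟩, ?_, ?_⟩ <;> linarith
  · rw [mem_cell_iff_coord hα]
    constructor
    · rintro ⟨⟨h1, h2, h3, h4⟩, ⟨h5, h6⟩, h7, h8⟩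
      exact ⟨h5, h1, h8⟩
    · rintro ⟨h1, h2, h3⟩
      refine ⟨⟨?_, ?_, ?_, ?_⟩, ⟨?_, ?_⟩, ?_, ?_⟩ <;> linarith

theorem bottomTri_piece {α : ℝ} (hα : 0 < α) {A B : Set ℝ} {s t : ℝ}
    (hU : IsGap A (-(α / 2)) (1 / 2) (-t) (-s)) (hV : IsGap B 0 ((1 + α) / 2) s t)
    (h1 : 0 ≤ s) (h2 : t ≤ α / 2) (h3 : t - s ≤ 1) :
    closure (wallTri α s t .bottom) ∈ cells α A B ∧
      volume (closure (wallTri α s t .bottom)) = ENNReal.ofReal ((t - s) ^ 2 / (4 * α)) := by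
  have hst := hV.lt
  refine exists_piece hα hU hV (s := -((2 * s + t) / 3)) (t := (s + 2 * t) / 3) ?_
    (volume_wallTri hα hst.le _) fun p => ?_
  · refine ⟨⟨?_, ?_, ?_, ?_⟩, ⟨?_, ?_⟩, ?_, ?_⟩ <;> linarith
  · rw [mem_cell_iff_coord hα]
    constructor
    · rintro ⟨⟨h1, h2, h3, h4⟩, ⟨h5, h6⟩, h7, h8⟩
      exact ⟨by linarith, by linarith, h8⟩
    · rintro ⟨h1, h2, h3⟩
      refine ⟨⟨?_, ?_, ?_, ?_⟩, ⟨?_, ?_⟩, ?_, ?_⟩ <;> linarith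

/-! ### Telling congruence classes of equal area apart -/

/-- The diameter of a set is large compared to its area. -/
def IsLong (P : Set Plane) : Prop :=
  ∃ x ∈ P, ∃ y ∈ P, 5 * volume P < ENNReal.ofReal (dist x y ^ 2)

/-- By Mazur–Ulam an isometry is a linear isometry followed by a translation. -/
theorem volume_image_isometryEquiv (e : Plane ≃ᵢ Plane) (P : Set Plane) :
    volume (e '' P) = volume P := by
  have h : e '' P = (fun x => x + e 0) '' (e.toRealLinearIsometryEquiv '' P) := by
    rw [Set.image_image]
    refine Set.image_congr fun x _ => ?_
    simp [IsometryEquiv.toRealLinearIsometryEquiv_apply]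
  rw [h, Set.image_add_right, measure_preimage_add_right]
  have h2 := (e.toRealLinearIsometryEquiv.symm.measurePreserving).measure_preimage_emb
    e.toRealLinearIsometryEquiv.symm.toIsometryEquiv.toHomeomorph.measurableEmbedding P
  rw [← h2]
  congr 1
  exact e.toRealLinearIsometryEquiv.toEquiv.image_eq_preimage_symm P

theorem SameShape.volume_eq {P Q : Set Plane} (h : SameShape P Q) : volume P = volume Q := by
  obtain ⟨e, rfl⟩ := h
  exact (volume_image_isometryEquiv e P).symm

theorem SameShape.isLong {P Q : Set Plane} (h : SameShape P Q) (hP : IsLong P) : IsLong Q := by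
  have hv := h.volume_eq
  obtain ⟨e, rfl⟩ := h
  obtain ⟨x, hx, y, hy, hxy⟩ := hP
  exact ⟨e x, ⟨x, hx, rfl⟩, e y, ⟨y, hy, rfl⟩, by rwa [← hv, e.dist_eq]⟩

theorem dist_sq_eq (x y : Plane) : dist x y ^ 2 = (x 0 - y 0) ^ 2 + (x 1 - y 1) ^ 2 := by
  rw [EuclideanSpace.dist_eq, Real.sq_sqrt (by positivity), Fin.sum_univ_two, Real.dist_eq,
    Real.dist_eq, sq_abs, sq_abs]

/-- The triangle lies in a rectangle of height `t - s` and width `(t - s) / (2α)`. The square of the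
diagonal is at most five times the area exactly when `4α² + 1 ≤ 5α`, that is, for `1/4 ≤ α ≤ 1`. -/
theorem not_isLong_leftTri {α s t : ℝ} (h1 : 1 / 4 ≤ α) (h2 : α ≤ 1) (hst : s < t)
    (hv : volume (closure (wallTri α s t .left)) = ENNReal.ofReal ((t - s) ^ 2 / (4 * α))) :
    ¬IsLong (closure (wallTri α s t .left)) := by
  rintro ⟨x, hx, y, hy, h⟩
  have hα : 0 < α := by linarith
  have key : ∀ p ∈ closure (wallTri α s t .left),
      s ≤ coordU α p ∧ coordU α p ≤ coordV α p ∧ coordV α p ≤ t := by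
    intro p hp
    have hcl : IsClosed {p : Plane | s ≤ coordU α p ∧ coordU α p ≤ coordV α p ∧ coordV α p ≤ t} :=
      (isClosed_le continuous_const (continuous_coordU α)).inter
        ((isClosed_le (continuous_coordU α) (continuous_coordV α)).inter
          (isClosed_le (continuous_coordV α) continuous_const))
    refine closure_minimal ?_ hcl hp
    exact fun q hq => ⟨hq.1.le, hq.2.1.le, hq.2.2.le⟩
  obtain ⟨a1, a2, a3⟩ := key x hx
  obtain ⟨b1, b2, b3⟩ := key y hy
  rw [hv, show (5 : ENNReal) = ENNReal.ofReal 5 by simp, ← ENNReal.ofReal_mul (by norm_num),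
    dist_sq_eq] at h
  have h3 := (ENNReal.ofReal_lt_ofReal_iff_of_nonneg (by positivity)).1 h
  unfold coordU coordV at *
  have e0 : (2 * α * (x 0 - y 0)) ^ 2 ≤ (t - s) ^ 2 := by
    rw [sq_le_sq, abs_of_pos (show 0 < t - s by linarith), abs_le]
    constructor <;> nlinarith
  have e1 : (x 1 - y 1) ^ 2 ≤ (t - s) ^ 2 := by
    rw [sq_le_sq, abs_of_pos (show 0 < t - s by linarith), abs_le]
    constructor <;> nlinarith
  have h4 : 5 * (t - s) ^ 2 * α < 4 * α ^ 2 * ((x 0 - y 0) ^ 2 + (x 1 - y 1) ^ 2) := by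
    have := mul_lt_mul_of_pos_left h3 (show 0 < 4 * α ^ 2 by positivity)
    calc 5 * (t - s) ^ 2 * α = 4 * α ^ 2 * (5 * ((t - s) ^ 2 / (4 * α))) := by field_simp
      _ < _ := this
  have h5 : 4 * α ^ 2 * (x 1 - y 1) ^ 2 ≤ 4 * α ^ 2 * (t - s) ^ 2 := by gcongr
  -- The factored form of `4α² + 1 ≤ 5α`.
  have h6 : 0 ≤ (4 * α - 1) * (1 - α) * (t - s) ^ 2 := by
    have : 0 ≤ 4 * α - 1 := by linarith
    have : 0 ≤ 1 - α := by linarith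
    positivity
  nlinarith

theorem isLong_bottomTri {α s t : ℝ} (hα : 0 < α) (h2 : α ≤ 1 / 2) (hst : s < t)
    (hv : volume (closure (wallTri α s t .bottom)) = ENNReal.ofReal ((t - s) ^ 2 / (4 * α))) :
    IsLong (closure (wallTri α s t .bottom)) := by
  -- Two interior points near the ends of the base, which has length `(t - s) / α`. Their horizontal
  -- distance is `93/100` of it, enough to beat five times the area when `α ≤ 1/2`.
  refine ⟨ofCoord α (-(s + (t - s) / 50)) (s + (t - s) / 20), subset_closure ?_,
    ofCoord α (-(s + (t - s) * 19 / 20)) (s + (t - s) * 49 / 50), subset_closure ?_, ?_⟩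
  · refine ⟨?_, ?_, ?_⟩ <;> simp only [coordU_ofCoord hα, coordV_ofCoord hα] <;> linarith
  · refine ⟨?_, ?_, ?_⟩ <;> simp only [coordU_ofCoord hα, coordV_ofCoord hα] <;> linarith
  rw [hv, show (5 : ENNReal) = ENNReal.ofReal 5 by simp, ← ENNReal.ofReal_mul (by norm_num),
    dist_sq_eq]
  have hpos : 0 < (t - s) ^ 2 := by
    have : 0 < t - s := by linarith
    positivity
  rw [ENNReal.ofReal_lt_ofReal_iff_of_nonneg (by positivity)]
  simp only [ofCoord, PiLp.toLp_apply, Matrix.cons_val_zero, Matrix.cons_val_one]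
  have e : ((s + (t - s) / 20 - -(s + (t - s) / 50)) / (2 * α) -
      (s + (t - s) * 49 / 50 - -(s + (t - s) * 19 / 20)) / (2 * α)) ^ 2 =
      (93 / 100) ^ 2 * (t - s) ^ 2 / α ^ 2 := by
    field_simp; ring
  rw [e]
  have : 5 * ((t - s) ^ 2 / (4 * α)) < (93 / 100) ^ 2 * (t - s) ^ 2 / α ^ 2 := by
    rw [← mul_div_assoc, div_lt_div_iff₀ (by positivity) (by positivity)]
    have : 0 < (t - s) ^ 2 * α := by positivity
    nlinarith
  have h0 := sq_nonneg ((-(s + (t - s) / 50) + (s + (t - s) / 20)) / 2 -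
    (-(s + (t - s) * 19 / 20) + (s + (t - s) * 49 / 50)) / 2)
  linarith

/-! ### Thirteen areas and sixteen shapes in the example -/

/-- Twice `α` times the areas of the pieces in the extremal example. -/
noncomputable def areaList : Fin 13 → ℝ :=
  -- The three gap lengths, with `c = a + b`. The quarters of squares belong to the corner pieces,
  -- the halves to triangles on a wall, the products to parallelograms, and the factor `7α - 3` to
  -- the piece at the end of the orbit.
  let a := 5 - 11 * slope
  let b := 9 * slope - 4
  let c := 1 - 2 * slope
  ![a ^ 2 / 4, a ^ 2 / 2, a * a, b ^ 2 / 4, a * b, b ^ 2 / 2, c ^ 2 / 4, a * (7 * slope - 3) / 2,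
    a * c, b * b, c ^ 2 / 2, b * c, c * c]

/-- Substituting `α² = 10/49` makes every comparison of neighbours linear in `α`, and the decimal
bounds decide it. -/
theorem areaList_strictMono : StrictMono areaList := by
  have s1 := slope_gt
  have s2 := slope_lt
  have s3 := slope_sq
  rw [Fin.strictMono_iff_lt_succ]
  intro i
  fin_cases i <;> simp [areaList] <;> ring_nf at * <;> linarith

theorem areaList_pos (i : Fin 13) : 0 < areaList i := by
  have s1 := slope_gt
  have s2 := slope_lt
  have h0 : 0 < areaList 0 := by
    have : 0 < 5 - 11 * slope := by linarith
    simp only [areaList, Matrix.cons_val_zero]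
    positivity
  exact h0.trans_le (areaList_strictMono.monotone (Fin.zero_le i))

/-- The positions in `areaList` of the areas of the triangles that are half of a rhombus. -/
def triIndex : Fin 3 → Fin 13 := ![1, 5, 10]

/-- The pieces in the extremal example. -/
abbrev slopeCells : Set (Set Plane) := cells slope (linesU slope 11) (linesV slope 11)

theorem exists_leftTri_slope (j : Fin 3) : ∃ P ∈ slopeCells,
    volume P = ENNReal.ofReal (areaList (triIndex j) / (2 * slope)) ∧ ¬IsLong P := by
  have s0 := slope_pos
  have s1 := slope_gt
  have s2 := slope_lt
  have key : ∀ {s t X : ℝ}, IsGap (linesU slope 11) (-(slope / 2)) (1 / 2) s t →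
      IsGap (linesV slope 11) 0 ((1 + slope) / 2) s t → t ≤ 1 / 2 → t - s ≤ slope →
      (t - s) ^ 2 / 2 = X → ∃ P ∈ slopeCells,
        volume P = ENNReal.ofReal (X / (2 * slope)) ∧ ¬IsLong P := by
    rintro s t X hU hV h1 h2 rfl
    obtain ⟨h3, h4⟩ := leftTri_piece s0 hU hV hV.lo_le h1 h2
    refine ⟨_, h3, ?_, not_isLong_leftTri (by linarith) (by linarith) hU.lt h4⟩
    rw [h4]; congr 1; ring
  obtain ⟨-, -, -, -, u1, u2, u3, -⟩ := gapsU_slope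
  obtain ⟨v1, v2, v3, -⟩ := gapsV_slope
  fin_cases j
  · exact key u3 v3 (by simp only [lin]; push_cast; linarith) (by simp only [lin]; push_cast; linarith)
      (by simp [areaList, triIndex]; ring)
  · exact key u2 v2 (by simp only [lin]; push_cast; linarith) (by simp only [lin]; push_cast; linarith)
      (by simp [areaList, triIndex]; ring)
  · exact key u1 v1 (by simp only [lin]; push_cast; linarith) (by simp only [lin]; push_cast; linarith)
      (by simp [areaList, triIndex]; ring)

theorem exists_bottomTri_slope (j : Fin 3) : ∃ P ∈ slopeCells,
    volume P = ENNReal.ofReal (areaList (triIndex j) / (2 * slope)) ∧ IsLong P := by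
  have s0 := slope_pos
  have s1 := slope_gt
  have s2 := slope_lt
  have key : ∀ {s t s' t' X : ℝ}, IsGap (linesU slope 11) (-(slope / 2)) (1 / 2) t' s' →
      IsGap (linesV slope 11) 0 ((1 + slope) / 2) s t → t' = -t → s' = -s → t ≤ slope / 2 →
      (t - s) ^ 2 / 2 = X → ∃ P ∈ slopeCells,
        volume P = ENNReal.ofReal (X / (2 * slope)) ∧ IsLong P := by
    rintro s t _ _ X hU hV rfl rfl h1 rfl
    have h2 := hV.lo_le
    obtain ⟨h3, h4⟩ := bottomTri_piece s0 hU hV hV.lo_le h1 (by linarith)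
    refine ⟨_, h3, ?_, isLong_bottomTri s0 (by linarith) hV.lt h4⟩
    rw [h4]; congr 1; ring
  obtain ⟨-, u3, u2, u1, -⟩ := gapsU_slope
  obtain ⟨v1, v2, v3, -⟩ := gapsV_slope
  fin_cases j
  · exact key u3 v3 (by simp only [lin]; push_cast; ring) (by simp only [lin]; push_cast; ring) (by simp only [lin]; push_cast; linarith)
      (by simp [areaList, triIndex]; ring)
  · exact key u2 v2 (by simp only [lin]; push_cast; ring) (by simp only [lin]; push_cast; ring) (by simp only [lin]; push_cast; linarith)
      (by simp [areaList, triIndex]; ring)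
  · exact key u1 v1 (by simp only [lin]; push_cast; ring) (by simp only [lin]; push_cast; ring) (by simp only [lin]; push_cast; linarith)
      (by simp [areaList, triIndex]; ring)

theorem exists_box_slope {a b c d X : ℝ}
    (hU : IsGap (linesU slope 11) (-(slope / 2)) (1 / 2) a b)
    (hV : IsGap (linesV slope 11) 0 ((1 + slope) / 2) c d)
    (h1 : b ≤ c) (h2 : b + d ≤ 1) (h3 : 0 ≤ a + c) (h4 : d - a ≤ slope)
    (hX : (b - a) * (d - c) = X) :
    ∃ P ∈ slopeCells, volume P = ENNReal.ofReal (X / (2 * slope)) := by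
  rw [← hX]
  exact box_piece slope_pos hU hV h1 h2 h3 h4

theorem exists_topRight_slope :
    ∃ P ∈ slopeCells, volume P = ENNReal.ofReal (areaList 0 / (2 * slope)) := by
  have s0 := slope_pos
  have s1 := slope_gt
  have s2 := slope_lt
  obtain ⟨-, -, -, -, -, -, -, u, -⟩ := gapsU_slope
  obtain ⟨-, -, -, -, -, -, -, v⟩ := gapsV_slope
  -- The decimals are the coordinates of a point witnessing that the cell is nonempty. The region is
  -- sliced by `coordV`, because for fixed `v` it runs from the right wall `u = v - α` to the top
  -- wall `u = 1 - v`.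
  refine ⟨_, exists_piece s0 u v (s := 0.275) (t := 0.72) ?_
    ((volume_between_swap s0 v.lt.le (-slope) 1 1 (-1) ?_).trans ?_) fun p => ?_⟩
  · simp only [lin]; push_cast
    refine ⟨⟨?_, ?_, ?_, ?_⟩, ⟨?_, ?_⟩, ?_, ?_⟩ <;> linarith
  · intro s h1 h2; linarith
  · congr 2
    simp only [areaList, Matrix.cons_val_zero]
    simp only [lin]; push_cast; ring
  · rw [mem_cell_iff_coord s0]
    simp only [lin]; push_cast
    constructor
    · rintro ⟨⟨h1, h2, h3, h4⟩, ⟨h5, h6⟩, h7, h8⟩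
      refine ⟨⟨?_, ?_⟩, ?_, ?_⟩ <;> linarith
    · rintro ⟨⟨h1, h2⟩, h3, h4⟩
      refine ⟨⟨?_, ?_, ?_, ?_⟩, ⟨?_, ?_⟩, ?_, ?_⟩ <;> linarith

theorem exists_bottomRight_slope :
    ∃ P ∈ slopeCells, volume P = ENNReal.ofReal (areaList 3 / (2 * slope)) := by
  have s0 := slope_pos
  have s1 := slope_gt
  have s2 := slope_lt
  obtain ⟨u, -⟩ := gapsU_slope
  obtain ⟨-, -, -, v, -⟩ := gapsV_slope
  refine ⟨_, exists_piece s0 u v (s := -0.22) (t := 0.226) ?_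
    ((volume_between s0 u.lt.le 0 (-1) slope 1 ?_).trans ?_) fun p => ?_⟩
  · simp only [lin]; push_cast
    refine ⟨⟨?_, ?_, ?_, ?_⟩, ⟨?_, ?_⟩, ?_, ?_⟩ <;> linarith
  · intro s h1 h2; linarith
  · congr 2
    simp [areaList]
    ring
  · rw [mem_cell_iff_coord s0]
    simp only [lin]; push_cast
    constructor
    · rintro ⟨⟨h1, h2, h3, h4⟩, ⟨h5, h6⟩, h7, h8⟩
      refine ⟨⟨?_, ?_⟩, ?_, ?_⟩ <;> linarith
    · rintro ⟨⟨h1, h2⟩, h3, h4⟩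
      refine ⟨⟨?_, ?_, ?_, ?_⟩, ⟨?_, ?_⟩, ?_, ?_⟩ <;> linarith

theorem exists_topLeft_slope :
    ∃ P ∈ slopeCells, volume P = ENNReal.ofReal (areaList 6 / (2 * slope)) := by
  have s0 := slope_pos
  have s1 := slope_gt
  have s2 := slope_lt
  obtain ⟨-, -, -, -, -, -, -, -, -, u⟩ := gapsU_slope
  obtain ⟨-, -, -, -, -, -, v, -⟩ := gapsV_slope
  refine ⟨_, exists_piece s0 u v (s := 0.48) (t := 0.5) ?_
    ((volume_between s0 u.lt.le 0 1 1 (-1) ?_).trans ?_) fun p => ?_⟩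
  · simp only [lin]; push_cast
    refine ⟨⟨?_, ?_, ?_, ?_⟩, ⟨?_, ?_⟩, ?_, ?_⟩ <;> linarith
  · intro s h1 h2; linarith
  · congr 2
    simp [areaList]
    ring
  · rw [mem_cell_iff_coord s0]
    simp only [lin]; push_cast
    constructor
    · rintro ⟨⟨h1, h2, h3, h4⟩, ⟨h5, h6⟩, h7, h8⟩
      refine ⟨⟨?_, ?_⟩, ?_, ?_⟩ <;> linarith
    · rintro ⟨⟨h1, h2⟩, h3, h4⟩
      refine ⟨⟨?_, ?_, ?_, ?_⟩, ⟨?_, ?_⟩, ?_, ?_⟩ <;> linarith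

/-- The line `u = 4 - 8α` has index `-12`, which the window `-11..11` of the other family lacks. The
gap in `v` therefore runs past this wall point up to `α`, and the piece is a trapezoid instead of a
triangle. -/
theorem exists_end_slope :
    ∃ P ∈ slopeCells, volume P = ENNReal.ofReal (areaList 7 / (2 * slope)) := by
  have s0 := slope_pos
  have s1 := slope_gt
  have s2 := slope_lt
  obtain ⟨-, -, -, -, -, -, -, -, u, -⟩ := gapsU_slope
  obtain ⟨-, -, -, -, -, v, -⟩ := gapsV_slope
  refine ⟨_, exists_piece s0 u v (s := 0.37) (t := 0.4) ?_
    ((volume_between s0 u.lt.le 0 1 slope 0 ?_).trans ?_) fun p => ?_⟩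
  · simp only [lin]; push_cast
    refine ⟨⟨?_, ?_, ?_, ?_⟩, ⟨?_, ?_⟩, ?_, ?_⟩ <;> linarith
  · simp only [lin]; push_cast
    intro s h1 h2; linarith
  · congr 2
    simp [areaList]
    ring
  · rw [mem_cell_iff_coord s0]
    simp only [lin]; push_cast
    constructor
    · rintro ⟨⟨h1, h2, h3, h4⟩, ⟨h5, h6⟩, h7, h8⟩
      refine ⟨⟨?_, ?_⟩, ?_, ?_⟩ <;> linarith
    · rintro ⟨⟨h1, h2⟩, h3, h4⟩
      refine ⟨⟨?_, ?_, ?_, ?_⟩, ⟨?_, ?_⟩, ?_, ?_⟩ <;> linarith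

/-- The last clause fixes the left triangle as representative of each half-rhombus area, so that it
can be compared with the bottom triangle. -/
theorem exists_piece_slope (i : Fin 13) : ∃ P ∈ slopeCells,
    volume P = ENNReal.ofReal (areaList i / (2 * slope)) ∧ (i ∈ Set.range triIndex → ¬IsLong P) := by
  by_cases hi : i ∈ Set.range triIndex
  · obtain ⟨j, rfl⟩ := hi
    obtain ⟨P, h1, h2, h3⟩ := exists_leftTri_slope j
    exact ⟨P, h1, h2, fun _ => h3⟩
  suffices h : ∃ P ∈ slopeCells, volume P = ENNReal.ofReal (areaList i / (2 * slope)) by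
    obtain ⟨P, h1, h2⟩ := h
    exact ⟨P, h1, h2, fun h => absurd h hi⟩
  have s1 := slope_gt
  have s2 := slope_lt
  obtain ⟨-, -, u₁, u₂, u₃, u₄, u₅, -⟩ := gapsU_slope
  obtain ⟨-, v₁, v₂, v₃, v₄, v₅, -⟩ := gapsV_slope
  fin_cases i
  · exact exists_topRight_slope
  · exact absurd ⟨0, rfl⟩ hi
  · exact exists_box_slope u₅ v₄ (by simp only [lin]; push_cast; linarith) (by simp only [lin]; push_cast; linarith)
      (by simp only [lin]; push_cast; linarith) (by simp only [lin]; push_cast; linarith) (by simp [areaList]; ring)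
  · exact exists_bottomRight_slope
  · exact exists_box_slope u₁ v₂ (by simp only [lin]; push_cast; linarith) (by simp only [lin]; push_cast; linarith)
      (by simp only [lin]; push_cast; linarith) (by simp only [lin]; push_cast; linarith) (by simp [areaList]; ring)
  · exact absurd ⟨1, rfl⟩ hi
  · exact exists_topLeft_slope
  · exact exists_end_slope
  · exact exists_box_slope u₂ v₂ (by simp only [lin]; push_cast; linarith) (by simp only [lin]; push_cast; linarith)
      (by simp only [lin]; push_cast; linarith) (by simp only [lin]; push_cast; linarith) (by simp [areaList]; ring)
  · exact exists_box_slope u₄ v₃ (by simp only [lin]; push_cast; linarith) (by simp only [lin]; push_cast; linarith)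
      (by simp only [lin]; push_cast; linarith) (by simp only [lin]; push_cast; linarith) (by simp [areaList]; ring)
  · exact absurd ⟨2, rfl⟩ hi
  · exact exists_box_slope u₂ v₁ (by simp only [lin]; push_cast; linarith) (by simp only [lin]; push_cast; linarith)
      (by simp only [lin]; push_cast; linarith) (by simp only [lin]; push_cast; linarith) (by simp [areaList]; ring)
  · exact exists_box_slope u₃ v₅ (by simp only [lin]; push_cast; linarith) (by simp only [lin]; push_cast; linarith)
      (by simp only [lin]; push_cast; linarith) (by simp only [lin]; push_cast; linarith) (by simp [areaList]; ring)

theorem area_injective :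
    Function.Injective fun i => ENNReal.ofReal (areaList i / (2 * slope)) := by
  intro i j h
  have s0 := slope_pos
  have hi := areaList_pos i
  have hj := areaList_pos j
  have := (ENNReal.ofReal_eq_ofReal_iff (by positivity) (by positivity)).1 h
  exact areaList_strictMono.injective ((div_left_inj' (by positivity)).1 this)

theorem le_encard_of_injective {ι β : Type*} [Fintype ι] {f : ι → β} (hf : f.Injective)
    {S : Set β} (h : ∀ i, f i ∈ S) : (Fintype.card ι : ℕ∞) ≤ S.encard := by
  have h1 : (f '' Set.univ).encard = Fintype.card ι := by
    rw [hf.encard_image, Set.encard_univ, ENat.card_eq_coe_fintype_card]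
  rw [← h1]
  exact Set.encard_le_encard (by rintro _ ⟨i, -, rfl⟩; exact h i)

theorem pieces_slope : pieces slope 8 = slopeCells := by
  rw [pieces_eq_cells slope_pos orbitPoint_slope, lastBox_slope]
  norm_num

theorem le_numAreas_slope : 13 ≤ numAreas slope 8 := by
  rw [numAreas, pieces_slope]
  refine le_encard_of_injective area_injective fun i => ?_
  obtain ⟨P, h1, h2, -⟩ := exists_piece_slope i
  exact ⟨P, h1, h2⟩

/-- The thirteen representatives differ in area, and so do the three bottom triangles among
themselves. A bottom triangle can share its area only with a left triangle, which is not long while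
the bottom one is. -/
theorem le_numShapes_slope : 16 ≤ numShapes slope 8 := by
  rw [numShapes, pieces_slope]
  choose P hP hvP hlP using exists_piece_slope
  choose Q hQ hvQ hlQ using exists_bottomTri_slope
  have htri : triIndex.Injective := by decide
  have hinj : Function.Injective (Sum.elim (fun i => Quotient.mk shapeSetoid (P i))
      fun j => Quotient.mk shapeSetoid (Q j)) := by
    have hne : ∀ i j, Quotient.mk shapeSetoid (P i) ≠ Quotient.mk shapeSetoid (Q j) := by
      intro i j h
      have hs : SameShape (P i) (Q j) := Quotient.exact h
      have hv := hs.volume_eq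
      rw [hvP, hvQ] at hv
      obtain rfl := area_injective hv
      exact hlP _ ⟨j, rfl⟩ (hs.symm.isLong (hlQ j))
    rintro (i | i) (j | j) h
    · have hv := SameShape.volume_eq (Quotient.exact h)
      rw [hvP, hvP] at hv
      rw [area_injective hv]
    · exact absurd h (hne i j)
    · exact absurd h.symm (hne j i)
    · have hv := SameShape.volume_eq (Quotient.exact h)
      rw [hvQ, hvQ] at hv
      rw [htri (area_injective hv)]
  refine le_encard_of_injective hinj ?_
  rintro (i | j)
  · exact ⟨P i, hP i, rfl⟩
  · exact ⟨Q j, hQ j, rfl⟩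

end Billiard

theorem mainTheorem1 :
    (∀ α M : ℝ, 0 < α → 0 < M →
      Billiard.orbitPoint α M ∈ Billiard.table \ Billiard.openTable →
        Billiard.IsPolygonPartition (Billiard.pieces α M) Billiard.table ∧
        Billiard.numAreas α M ≤ 13 ∧ Billiard.numShapes α M ≤ 16) ∧
    (∃ M : ℝ, 0 < M ∧ Billiard.CompletesSquares (Real.sqrt 10 / 7) 11 M ∧
      Billiard.orbitPoint (Real.sqrt 10 / 7) M ∈ Billiard.table \ Billiard.openTable ∧
      Billiard.numAreas (Real.sqrt 10 / 7) M = 13 ∧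
      Billiard.numShapes (Real.sqrt 10 / 7) M = 16) := by
  refine ⟨fun α M hα hM h => Billiard.partition_and_bounds hα hM h, 8, by norm_num,
    Billiard.completesSquares_slope, Billiard.orbitPoint_slope, ?_, ?_⟩
  · exact le_antisymm
      (Billiard.partition_and_bounds Billiard.slope_pos (by norm_num) Billiard.orbitPoint_slope).2.1
      Billiard.le_numAreas_slope
  · exact le_antisymm
      (Billiard.partition_and_bounds Billiard.slope_pos (by norm_num) Billiard.orbitPoint_slope).2.2
      Billiard.le_numShapes_slope
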